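/- Let $\mathcal H$ be a complex separable Hilbert space, $\mathcal B_1(\mathcal H)$ the trace class operators on $\mathcal H$ with the trace norm, and $\operatorname{tr}$ the trace. Let $H_0$ be a (possibly unbounded) self-adjoint operator in $\mathcal H$ with domain $\operatorname{dom}(H_0)$, let $\Omega\subseteq\mathbb R$ be an open interval with $0\in\Omega$, and let $\{V(s)\}_{s\in\Omega}\subset\mathcal B_1(\mathcal H)$ be a family of self-adjoint trace class operators that is continuously differentiable in $\mathcal B_1(\mathcal H)$-norm with respect to $s\in\Omega$. Put $H(s)=H_0+V(s)$ with $\operatorname{dom}(H(s))=\operatorname{dom}(H_0)$, $s\in\Omega$. Let $(s_1,s_2)\subseteq\Omega$ be an open interval, and suppose in addition that $V'(s)$ is continuously differentiable in $\mathcal B_1(\mathcal H)$-norm with respect to $s\in(s_1,s_2)$ and that $$0\ge V''(s)\in\mathcal B_1(\mathcal H),\qquad s\in(s_1,s_2).$$ Let $\varphi:\mathbb R\to\mathbb R$ be a bounded, nonnegative, nonincreasing, real-analytic function admitting an analytic continuation to a domain (open connected set) $\mathcal D\subseteq\mathbb C$ containing the real axis. For $s\in(s_1,s_2)$ let $\varphi(H(s))=\int_{\mathbb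 R}\varphi(\lambda)\,dE_{H(s)}(\lambda)$, where $E_{H(s)}$ is the projection-valued spectral measure of the self-adjoint operator $H(s)$. Then $\varphi(H(s))$ is a well-defined bounded operator, $V'(s)\varphi(H(s))$ is trace class with real trace for every $s\in(s_1,s_2)$, and the function $$s\longmapsto\operatorname{tr}\bigl(V'(s)\,\varphi(H(s))\bigr),\qquad s\in(s_1,s_2),$$ is nonincreasing on $(s_1,s_2)$. -/

import Mathlib

open MeasureTheory Filter Topology Set
open scoped ENNReal

noncomputable section

namespace TraceMonotone

variable {𝓗 : Type*} [NormedAddCommGroup 𝓗] [InnerProductSpace ℂ 𝓗] [CompleteSpace 𝓗]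

/-! ### Trace class operators -/

/-- Index set of a fixed orthonormal (Hilbert) basis of `𝓗`. -/
def basisIndex (𝓗 : Type*) [NormedAddCommGroup 𝓗] [InnerProductSpace ℂ 𝓗]
    [CompleteSpace 𝓗] : Set 𝓗 :=
  (exists_hilbertBasis ℂ 𝓗).choose

/-- A fixed orthonormal (Hilbert) basis of `𝓗`. -/
def basis (𝓗 : Type*) [NormedAddCommGroup 𝓗] [InnerProductSpace ℂ 𝓗]
    [CompleteSpace 𝓗] : HilbertBasis (basisIndex 𝓗) ℂ 𝓗 :=
  (exists_hilbertBasis ℂ 𝓗).choose_spec.choose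

/-- The trace norm `‖A‖₁ = tr |A| = ∑ᵢ ⟨eᵢ, |A| eᵢ⟩ ∈ [0, ∞]`, where `|A| = (A* A)^{1/2}`
(the value does not depend on the orthonormal basis). -/
def traceNorm (A : 𝓗 →L[ℂ] 𝓗) : ℝ≥0∞ :=
  ∑' i, ENNReal.ofReal (inner ℂ (basis 𝓗 i) (CFC.abs A (basis 𝓗 i))).re

/-- `A ∈ 𝓑₁(𝓗)`. -/
def IsTraceClass (A : 𝓗 →L[ℂ] 𝓗) : Prop := traceNorm A < ∞

/-- The trace `tr A = ∑ᵢ ⟨eᵢ, A eᵢ⟩` of a trace class operator (absolutely convergent and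
independent of the orthonormal basis when `A` is trace class). -/
def trace (A : 𝓗 →L[ℂ] 𝓗) : ℂ :=
  ∑' i, inner ℂ (basis 𝓗 i) (A (basis 𝓗 i))

/-- The family `W` is differentiable at `s` in trace norm, with derivative `W'` in `𝓑₁(𝓗)`. -/
def HasTraceNormDerivAt (W : ℝ → 𝓗 →L[ℂ] 𝓗) (W' : 𝓗 →L[ℂ] 𝓗) (s : ℝ) : Prop :=
  IsTraceClass W' ∧
    Tendsto (fun t : ℝ => traceNorm (((t - s : ℝ) : ℂ)⁻¹ • (W t - W s) - W')) (𝓝[≠] s) (𝓝 0)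

/-- The family `W` is continuous in trace norm on the open set `S`. -/
def TraceNormContinuousOn (W : ℝ → 𝓗 →L[ℂ] 𝓗) (S : Set ℝ) : Prop :=
  ∀ s ∈ S, Tendsto (fun t : ℝ => traceNorm (W t - W s)) (𝓝[S] s) (𝓝 0)

/-! ### Functions of unbounded self-adjoint operators -/

/-- A projection-valued measure on the Borel sets of `ℝ`. Only the values on Borel sets matter;
`E ∅ = 0` and `E (A ∩ B) = E A * E B` follow from the listed properties. -/
structure ProjectionValuedMeasure (𝓗 : Type*) [NormedAddCommGroup 𝓗] [InnerProductSpace ℂ 𝓗]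
    [CompleteSpace 𝓗] where
  /-- The projection attached to a Borel set. -/
  proj : Set ℝ → 𝓗 →L[ℂ] 𝓗
  isStarProjection : ∀ A, MeasurableSet A → IsStarProjection (proj A)
  proj_univ : proj univ = 1
  hasSum_iUnion : ∀ A : ℕ → Set ℝ, (∀ n, MeasurableSet (A n)) →
    Pairwise (fun m n => Disjoint (A m) (A n)) →
    ∀ x : 𝓗, HasSum (fun n => proj (A n) x) (proj (⋃ n, A n) x)

theorem ProjectionValuedMeasure.proj_empty (E : ProjectionValuedMeasure 𝓗) : E.proj ∅ = 0 := by
  ext x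
  have h := E.hasSum_iUnion (fun _ => ∅) (fun _ => MeasurableSet.empty)
    (fun _ _ _ => disjoint_bot_left) x
  have h0 := h.summable.tendsto_atTop_zero
  simpa using tendsto_nhds_unique tendsto_const_nhds h0

theorem ProjectionValuedMeasure.re_inner_nonneg (E : ProjectionValuedMeasure 𝓗) {A : Set ℝ}
    (hA : MeasurableSet A) (x : 𝓗) : 0 ≤ (inner ℂ x (E.proj A x)).re := by
  have h := E.isStarProjection A hA
  have h1 : E.proj A x = E.proj A (E.proj A x) := by
    conv_lhs => rw [← h.isIdempotentElem.eq]
    rfl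
  have h2 : inner ℂ x (E.proj A (E.proj A x)) = inner ℂ (E.proj A x) (E.proj A x) := by
    rw [← ContinuousLinearMap.adjoint_inner_left,
      ContinuousLinearMap.isSelfAdjoint_iff'.mp h.isSelfAdjoint]
  rw [h1, h2]
  exact inner_self_nonneg (𝕜 := ℂ)

/-- The scalar spectral measure `A ↦ ⟨x, E(A) x⟩`. -/
def ProjectionValuedMeasure.scalarMeasure (E : ProjectionValuedMeasure 𝓗) (x : 𝓗) : Measure ℝ :=
  Measure.ofMeasurable (fun A _ => ENNReal.ofReal (inner ℂ x (E.proj A x)).re)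
    (by simp [E.proj_empty])
    (by
      intro A hA hd
      have h := (E.hasSum_iUnion A hA hd x).mapL (innerSL ℂ x)
      have h' := h.mapL Complex.reCLM
      have h'' : HasSum (fun n => (inner ℂ x (E.proj (A n) x)).re)
          (inner ℂ x (E.proj (⋃ n, A n) x)).re := h'
      rw [← h''.tsum_eq,
        ENNReal.ofReal_tsum_of_nonneg (fun n => E.re_inner_nonneg (hA n) x) h''.summable])

/-- `E` is the spectral measure of `T`, i.e. `T = ∫ λ dE(λ)`:
`dom T = {x | ∫ λ² d⟨x, E(λ) x⟩ < ∞}` and `⟨x, T x⟩ = ∫ λ d⟨x, E(λ) x⟩` for `x ∈ dom T`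
(by polarization this determines `T`). -/
def IsSpectralMeasure (E : ProjectionValuedMeasure 𝓗) (T : 𝓗 →ₗ.[ℂ] 𝓗) : Prop :=
  (∀ x : 𝓗, x ∈ T.domain ↔ Integrable (fun l : ℝ => l ^ 2) (E.scalarMeasure x)) ∧
  ∀ x : T.domain, inner ℂ (x : 𝓗) (T x) = ((∫ l, l ∂(E.scalarMeasure (x : 𝓗)) : ℝ) : ℂ)

/-- For a bounded Borel function `φ`: `B` is the bounded operator `φ(T) = ∫ φ(λ) dE(λ)`, where
`E` is the spectral measure of `T`. -/
def IsFunctionOf (T : 𝓗 →ₗ.[ℂ] 𝓗) (φ : ℝ → ℝ) (B : 𝓗 →L[ℂ] 𝓗) : Prop :=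
  ∃ E : ProjectionValuedMeasure 𝓗, IsSpectralMeasure E T ∧
    ∀ x : 𝓗, inner ℂ x (B x) = ((∫ l, φ l ∂(E.scalarMeasure x) : ℝ) : ℂ)

open Classical in
/-- The operator `φ(T)` for a self-adjoint `T` and a bounded Borel function `φ`
(with value `0` if there is no such operator). -/
def functionOf (φ : ℝ → ℝ) (T : 𝓗 →ₗ.[ℂ] 𝓗) : 𝓗 →L[ℂ] 𝓗 :=
  if h : ∃ B, IsFunctionOf T φ B then h.choose else 0

/-- The operator `H₀ + W` on `dom (H₀ + W) = dom H₀`, for a bounded operator `W`. -/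
def perturb (H₀ : 𝓗 →ₗ.[ℂ] 𝓗) (W : 𝓗 →L[ℂ] 𝓗) : 𝓗 →ₗ.[ℂ] 𝓗 where
  domain := H₀.domain
  toFun := H₀.toFun + (W : 𝓗 →ₗ[ℂ] 𝓗).comp H₀.domain.subtype

/-- `φ` admits an analytic continuation to a domain (open connected set) of the complex plane
containing the real axis. -/
def HasAnalyticContinuation (φ : ℝ → ℝ) : Prop :=
  ∃ (D : Set ℂ) (F : ℂ → ℂ), IsOpen D ∧ IsConnected D ∧ (∀ x : ℝ, (x : ℂ) ∈ D) ∧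
    DifferentiableOn ℂ F D ∧ ∀ x : ℝ, F x = φ x

end TraceMonotone

end

noncomputable section

namespace TraceMonotone

set_option linter.unusedSectionVars false

variable {𝓗 : Type*} [NormedAddCommGroup 𝓗] [InnerProductSpace ℂ 𝓗] [CompleteSpace 𝓗]

/-! ### Quadratic forms of bounded operators -/

/-! Fix `s < t` and put `D = (V t - V s) / (t - s)`. Since `V'' ≤ 0`, every quadratic form `⟨x, V(·)
x⟩` is concave, so `V' t ≤ D ≤ V' s` as operators (`operator_slope_bounds`). As `φ(H(s))` and
`φ(H(t))` are nonnegative and the trace pairing of nonnegative operators is nonnegative, `tr(V'(t)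
φ(H(t))) ≤ tr(D φ(H(t)))` and `tr(D φ(H(s))) ≤ tr(V'(s) φ(H(s)))`. The two are joined by `tr(D
φ(H(t))) ≤ tr(D φ(H(s)))`, that is, by `tr((K₁ - K₂)(φ(H₀ + K₁) - φ(H₀ + K₂))) ≤ 0` for
nonincreasing `φ` (`re_trace_sub_mul_le`). No derivative of `φ(H(s))` in `s` is taken.

For matrices this last inequality is a double sum over two eigenbases, with terms `|⟨e_j, f_k⟩|²
(φ(α_j) - φ(β_k)) (α_j - β_k) ≤ 0` (`re_traceMul_sub_nonpos`). The general case is a limit over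
compressions to finite-dimensional subspaces of `dom H₀`. The functional calculus of the
compressions converges strongly (`tendsto_func`): on a given vector the compressed resolvent
eventually equals the true one, and Stone-Weierstrass passes from resolvents to continuous
functions. Strong convergence suffices for the traces, because a self-adjoint trace class operator
is `L₁² - L₂²` with `L₁`, `L₂` Hilbert-Schmidt, and `tr(L² X) = ∑ ⟨L e_i, X L e_i⟩` admits dominated
convergence.

The existence of `φ(H(s))` rests on the spectral theorem (`exists_isSpectralMeasure`), obtained by
transporting to the line the spectral measure of the bounded normal operator `(A + i)⁻¹`. -/

theorem clm_ext_of_inner_self {S T : 𝓗 →L[ℂ] 𝓗} (h : ∀ x, inner ℂ x (S x) = inner ℂ x (T x)) :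
    S = T := by
  have : (S : 𝓗 →ₗ[ℂ] 𝓗) = T := by
    rw [← ext_inner_map]
    intro x
    have := congrArg (starRingEnd ℂ) (h x)
    simpa using this
  ext x
  exact congrArg (fun f : 𝓗 →ₗ[ℂ] 𝓗 => f x) this

/-- Polarization, with the parallelogram law controlling the four terms. The factor 2 is the price
of not assuming normality, and is harmless because only convergence is drawn from the bound. -/
theorem norm_le_two_mul_of_inner_self_le {T : 𝓗 →L[ℂ] 𝓗} {C : ℝ} (hC : 0 ≤ C)
    (h : ∀ x, ‖inner ℂ x (T x)‖ ≤ C * ‖x‖ ^ 2) : ‖T‖ ≤ 2 * C := by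
  have h' : ∀ x, ‖inner ℂ (T x) x‖ ≤ C * ‖x‖ ^ 2 := fun x => by
    rw [norm_inner_symm]; exact h x
  have key : ∀ x y : 𝓗, ‖inner ℂ (T y) x‖ ≤ C * (‖x‖ ^ 2 + ‖y‖ ^ 2) := by
    intro x y
    have hp := inner_map_polarization (T : 𝓗 →ₗ[ℂ] 𝓗) x y
    simp only [ContinuousLinearMap.coe_coe] at hp
    rw [hp, norm_div]
    have e1 := parallelogram_law_with_norm ℂ x y
    have e2 := parallelogram_law_with_norm ℂ x (Complex.I • y)
    have e3 : ‖Complex.I • y‖ = ‖y‖ := by simp [norm_smul]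
    rw [e3] at e2
    have n4 : ‖(4 : ℂ)‖ = 4 := by simp
    rw [n4, div_le_iff₀ (by norm_num)]
    have a1 := h' (x + y)
    have a2 := h' (x - y)
    have a3 := h' (x + Complex.I • y)
    have a4 := h' (x - Complex.I • y)
    calc _ ≤ ‖inner ℂ (T (x + y)) (x + y)‖ + ‖inner ℂ (T (x - y)) (x - y)‖
          + ‖inner ℂ (T (x + Complex.I • y)) (x + Complex.I • y)‖
          + ‖inner ℂ (T (x - Complex.I • y)) (x - Complex.I • y)‖ := by
            refine (norm_sub_le _ _).trans (add_le_add ((norm_add_le _ _).trans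
              (add_le_add (norm_sub_le _ _) ?_)) ?_) <;>
              rw [norm_mul, Complex.norm_I, one_mul]
      _ ≤ _ := by nlinarith
  refine T.opNorm_le_of_unit_norm (by positivity) ?_
  intro y hy
  by_cases h0 : T y = 0
  · simp [h0]; positivity
  have hn : ‖T y‖ ≠ 0 := by simpa using h0
  -- Test against the unit vector in the direction of `T y`; both squared norms are then 1, whence
  -- `2 * C`.
  have := key (((‖T y‖ : ℂ))⁻¹ • T y) y
  rw [inner_smul_right, inner_self_eq_norm_sq_to_K, norm_smul, hy] at this
  have e : ‖((‖T y‖ : ℂ))⁻¹‖ = ‖T y‖⁻¹ := by simp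
  rw [norm_mul, e, inv_mul_cancel₀ hn] at this
  simp only [norm_pow, Complex.coe_algebraMap, Complex.norm_real, norm_norm] at this
  have e5 : ‖T y‖⁻¹ * ‖T y‖ ^ 2 = ‖T y‖ := by field_simp
  rw [e5] at this
  linarith

/-! ### Bounded Borel functional calculus of a projection-valued measure -/

namespace ProjectionValuedMeasure

variable (E : ProjectionValuedMeasure 𝓗)

theorem scalarMeasure_apply (x : 𝓗) {S : Set ℝ} (hS : MeasurableSet S) :
    E.scalarMeasure x S = ENNReal.ofReal (inner ℂ x (E.proj S x)).re :=
  Measure.ofMeasurable_apply S hS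

theorem inner_proj_eq_norm_sq (x : 𝓗) {S : Set ℝ} (hS : MeasurableSet S) :
    inner ℂ x (E.proj S x) = ((‖E.proj S x‖ ^ 2 : ℝ) : ℂ) := by
  have h := E.isStarProjection S hS
  have h1 : E.proj S x = E.proj S (E.proj S x) := by
    conv_lhs => rw [← h.isIdempotentElem.eq]
    rfl
  have h2 : inner ℂ x (E.proj S (E.proj S x)) = inner ℂ (E.proj S x) (E.proj S x) := by
    rw [← ContinuousLinearMap.adjoint_inner_left,
      ContinuousLinearMap.isSelfAdjoint_iff'.mp h.isSelfAdjoint]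
  rw [h1, h2, inner_self_eq_norm_sq_to_K, ← h1]
  simp

theorem scalarMeasure_real (x : 𝓗) {S : Set ℝ} (hS : MeasurableSet S) :
    (E.scalarMeasure x).real S = ‖E.proj S x‖ ^ 2 := by
  rw [Measure.real, E.scalarMeasure_apply x hS, E.inner_proj_eq_norm_sq x hS,
    Complex.ofReal_re, ENNReal.toReal_ofReal (by positivity)]

theorem inner_proj (x : 𝓗) {S : Set ℝ} (hS : MeasurableSet S) :
    inner ℂ x (E.proj S x) = ((E.scalarMeasure x).real S : ℂ) := by
  rw [E.scalarMeasure_real x hS, E.inner_proj_eq_norm_sq x hS]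

instance (x : 𝓗) : IsFiniteMeasure (E.scalarMeasure x) :=
  ⟨by rw [E.scalarMeasure_apply x MeasurableSet.univ]; exact ENNReal.ofReal_lt_top⟩

theorem scalarMeasure_real_univ (x : 𝓗) : (E.scalarMeasure x).real univ = ‖x‖ ^ 2 := by
  rw [E.scalarMeasure_real x MeasurableSet.univ, E.proj_univ]; rfl

theorem proj_union {S T : Set ℝ} (hS : MeasurableSet S) (hT : MeasurableSet T)
    (hd : Disjoint S T) : E.proj (S ∪ T) = E.proj S + E.proj T := by
  apply clm_ext_of_inner_self
  intro x
  rw [add_apply, inner_add_right, E.inner_proj x hS, E.inner_proj x hT,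
    E.inner_proj x (hS.union hT), measureReal_union hd hT]
  push_cast
  rfl

/-- The sum `p + q` is again idempotent, so `pq + qp = 0`; multiplying by `p` on the right and on
the left gives `pqp = pq` and `pqp = -pq`. -/
theorem proj_mul_of_disjoint {S T : Set ℝ} (hS : MeasurableSet S) (hT : MeasurableSet T)
    (hd : Disjoint S T) : E.proj S * E.proj T = 0 := by
  have h1 := (E.isStarProjection _ hS).isIdempotentElem.eq
  have h2 := (E.isStarProjection _ hT).isIdempotentElem.eq
  have h3 := (E.isStarProjection _ (hS.union hT)).isIdempotentElem.eq
  rw [E.proj_union hS hT hd] at h3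
  set p := E.proj S
  set q := E.proj T
  have h4 : p * q + q * p = 0 := by
    have : (p + q) * (p + q) = p * p + q * q + (p * q + q * p) := by noncomm_ring
    rw [this, h1, h2] at h3
    simpa using h3
  have h5 : p * q = -(q * p) := eq_neg_of_add_eq_zero_left h4
  have h6 : p * q * p = p * q := by rw [h5, neg_mul, mul_assoc, h1]
  have h7 : p * q = -(p * q * p) := by
    conv_lhs => rw [← h1, mul_assoc, h5]
    rw [mul_neg, mul_assoc]
  rw [h6] at h7
  have h8 : (2 : ℂ) • (p * q) = 0 := by rw [two_smul]; nth_rewrite 1 [h7]; simp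
  exact (smul_eq_zero.mp h8).resolve_left two_ne_zero

theorem proj_mul {S T : Set ℝ} (hS : MeasurableSet S) (hT : MeasurableSet T) :
    E.proj S * E.proj T = E.proj (S ∩ T) := by
  have e1 : E.proj S = E.proj (S ∩ T) + E.proj (S \ T) := by
    rw [← E.proj_union (hS.inter hT) (hS.diff hT) disjoint_sdiff_inter.symm, inter_union_sdiff]
  have e2 : E.proj T = E.proj (S ∩ T) + E.proj (T \ S) := by
    rw [← E.proj_union (hS.inter hT) (hT.diff hS) (by rw [inter_comm]; exact disjoint_sdiff_inter.symm), inter_comm,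
      inter_union_sdiff]
  rw [e1, e2, add_mul, mul_add, mul_add, (E.isStarProjection _ (hS.inter hT)).isIdempotentElem.eq,
    E.proj_mul_of_disjoint (hS.inter hT) (hT.diff hS), E.proj_mul_of_disjoint (hS.diff hT) (hS.inter hT),
    E.proj_mul_of_disjoint (hS.diff hT) (hT.diff hS)]
  · simp
  · exact disjoint_left.mpr fun a h1 h2 => h1.2 h2.1
  · exact disjoint_left.mpr fun a h1 h2 => h1.2 h2.2
  · exact disjoint_left.mpr fun a h1 h2 => h2.2 h1.1

end ProjectionValuedMeasure

/-- Bounded Borel functions on the line. -/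
structure BddMeas (f : ℝ → ℂ) : Prop where
  measurable : Measurable f
  bdd : ∃ C : ℝ, ∀ l, ‖f l‖ ≤ C

namespace BddMeas

theorem const (c : ℂ) : BddMeas (fun _ => c) := ⟨measurable_const, ‖c‖, fun _ => le_rfl⟩

theorem add {f g : ℝ → ℂ} (hf : BddMeas f) (hg : BddMeas g) : BddMeas (fun l => f l + g l) := by
  obtain ⟨hf, C, hC⟩ := hf
  obtain ⟨hg, D, hD⟩ := hg
  exact ⟨hf.add hg, C + D, fun l => (norm_add_le _ _).trans (add_le_add (hC l) (hD l))⟩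

theorem mul {f g : ℝ → ℂ} (hf : BddMeas f) (hg : BddMeas g) : BddMeas (fun l => f l * g l) := by
  obtain ⟨hf, C, hC⟩ := hf
  obtain ⟨hg, D, hD⟩ := hg
  exact ⟨hf.mul hg, C * D, fun l => by
    rw [norm_mul]
    exact mul_le_mul (hC l) (hD l) (norm_nonneg _) ((norm_nonneg _).trans (hC l))⟩

theorem sub {f g : ℝ → ℂ} (hf : BddMeas f) (hg : BddMeas g) : BddMeas (fun l => f l - g l) := by
  simpa [sub_eq_add_neg] using hf.add ((const (-1)).mul hg)

theorem conj {f : ℝ → ℂ} (hf : BddMeas f) : BddMeas (fun l => starRingEnd ℂ (f l)) := by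
  obtain ⟨hf, C, hC⟩ := hf
  exact ⟨Complex.continuous_conj.measurable.comp hf, C, fun l => by simpa using hC l⟩

theorem indicator {S : Set ℝ} (hS : MeasurableSet S) : BddMeas (S.indicator fun _ => (1 : ℂ)) :=
  ⟨measurable_const.indicator hS, 1, fun l => by
    by_cases h : l ∈ S <;> simp [h]⟩

theorem simple (s : SimpleFunc ℝ ℂ) : BddMeas s := ⟨s.measurable, s.exists_forall_norm_le⟩

theorem ofReal {f : ℝ → ℝ} (hf : Measurable f) (h : ∃ C : ℝ, ∀ x, |f x| ≤ C) :
    BddMeas (fun l => (f l : ℂ)) :=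
  ⟨Complex.measurable_ofReal.comp hf, h.imp fun C hC l => by simpa using hC l⟩

theorem integrable {f : ℝ → ℂ} (hf : BddMeas f) (μ : Measure ℝ) [IsFiniteMeasure μ] :
    Integrable f μ := by
  obtain ⟨hf, C, hC⟩ := hf
  exact Integrable.of_bound hf.aestronglyMeasurable C (ae_of_all _ hC)

/-- The range is totally bounded, so rounding `f` to the nearest point of a finite `ε`-net is a
uniform approximation. -/
theorem exists_simpleFunc {f : ℝ → ℂ} (hf : BddMeas f) {ε : ℝ} (hε : 0 < ε) :
    ∃ s : SimpleFunc ℝ ℂ, ∀ l, ‖f l - s l‖ ≤ ε := by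
  obtain ⟨hf, C, hC⟩ := hf
  have hT : TotallyBounded (Metric.closedBall (0 : ℂ) C) :=
    (isCompact_closedBall 0 C).totallyBounded
  obtain ⟨t, htf, ht⟩ := Metric.totallyBounded_iff.mp hT ε hε
  have h0 : f 0 ∈ ⋃ y ∈ t, Metric.ball y ε := ht (by simpa using hC 0)
  have htn : t.Nonempty := by
    simp only [mem_iUnion] at h0
    obtain ⟨y, hy, -⟩ := h0
    exact ⟨y, hy⟩
  obtain ⟨e, he⟩ := htf.countable.exists_eq_range htn
  have hN : ∃ N, ∀ y ∈ t, ∃ k ≤ N, e k = y := by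
    choose! k hk using fun y (hy : y ∈ t) => (he ▸ hy : y ∈ range e)
    obtain ⟨N, hN⟩ := (htf.image k).bddAbove
    exact ⟨N, fun y hy => ⟨k y, hN (mem_image_of_mem k hy), hk y hy⟩⟩
  obtain ⟨N, hN⟩ := hN
  refine ⟨(SimpleFunc.nearestPt e N).comp f hf, fun l => ?_⟩
  have hl : f l ∈ ⋃ y ∈ t, Metric.ball y ε := ht (by simpa using hC l)
  simp only [mem_iUnion] at hl
  obtain ⟨y, hy, hyl⟩ := hl
  obtain ⟨k, hk, rfl⟩ := hN y hy
  have := SimpleFunc.edist_nearestPt_le e (f l) hk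
  rw [edist_dist, edist_dist, ENNReal.ofReal_le_ofReal_iff dist_nonneg] at this
  rw [← dist_eq_norm, dist_comm]
  refine this.trans ?_
  rw [dist_comm]
  exact (Metric.mem_ball.mp hyl).le

/-- Induction over bounded Borel functions. -/
theorem induction {P : ∀ f : ℝ → ℂ, BddMeas f → Prop}
    (hind : ∀ S (hS : MeasurableSet S), P (S.indicator fun _ => (1 : ℂ)) (indicator hS))
    (hadd : ∀ f g (hf : BddMeas f) (hg : BddMeas g), P f hf → P g hg →
      P (fun l => f l + g l) (hf.add hg))
    (hsmul : ∀ (c : ℂ) f (hf : BddMeas f), P f hf → P (fun l => c * f l) ((const c).mul hf))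
    (hlim : ∀ (f : ℝ → ℂ) (s : ℕ → ℝ → ℂ) (hf : BddMeas f) (hs : ∀ n, BddMeas (s n)),
      (∀ n l, ‖f l - s n l‖ ≤ 1 / ((n : ℝ) + 1)) → (∀ n, P (s n) (hs n)) → P f hf)
    {f : ℝ → ℂ} (hf : BddMeas f) : P f hf := by
  have hsimple : ∀ s : SimpleFunc ℝ ℂ, P s (simple s) := by
    intro s
    induction s using SimpleFunc.induction with
    | const c hS =>
      have := hsmul c _ (indicator hS) (hind _ hS)
      convert this using 1
      ext l
      simp only [SimpleFunc.coe_piecewise, SimpleFunc.coe_const]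
      by_cases h : l ∈ ‹Set ℝ› <;> simp [h]
    | add hd h1 h2 => exact hadd _ _ (simple _) (simple _) h1 h2
  choose s hs using fun n : ℕ => hf.exists_simpleFunc (Nat.one_div_pos_of_nat (α := ℝ) (n := n))
  exact hlim f (fun n => s n) hf (fun n => simple _) hs fun n => hsimple _

end BddMeas

/-! ### Operator integrals of bounded Borel functions -/

namespace ProjectionValuedMeasure

variable (E : ProjectionValuedMeasure 𝓗)

/-- `T = ∫ f dE` in the weak sense. -/
def HasIntegral (f : ℝ → ℂ) (T : 𝓗 →L[ℂ] 𝓗) : Prop :=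
  ∀ x, inner ℂ x (T x) = ∫ l, f l ∂E.scalarMeasure x

variable {E} in
theorem HasIntegral.norm_le {f : ℝ → ℂ} {T : 𝓗 →L[ℂ] 𝓗} (h : E.HasIntegral f T) {C : ℝ}
    (hC : ∀ l, ‖f l‖ ≤ C) : ‖T‖ ≤ 2 * C := by
  refine norm_le_two_mul_of_inner_self_le ((norm_nonneg _).trans (hC 0)) fun x => ?_
  rw [h x]
  refine (norm_integral_le_of_norm_le_const (ae_of_all _ hC)).trans ?_
  rw [E.scalarMeasure_real_univ]

variable {E} in
theorem HasIntegral.add {f g : ℝ → ℂ} {S T : 𝓗 →L[ℂ] 𝓗} (hf : BddMeas f) (hg : BddMeas g)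
    (h : E.HasIntegral f S) (h' : E.HasIntegral g T) :
    E.HasIntegral (fun l => f l + g l) (S + T) := fun x => by
  rw [integral_add (hf.integrable _) (hg.integrable _), add_apply,
    inner_add_right, h x, h' x]

variable {E} in
theorem HasIntegral.const_mul {f : ℝ → ℂ} {S : 𝓗 →L[ℂ] 𝓗} (c : ℂ) (h : E.HasIntegral f S) :
    E.HasIntegral (fun l => c * f l) (c • S) := fun x => by
  rw [integral_const_mul, smul_apply, inner_smul_right, h x]

variable {E} in
theorem HasIntegral.sub {f g : ℝ → ℂ} {S T : 𝓗 →L[ℂ] 𝓗} (hf : BddMeas f) (hg : BddMeas g)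
    (h : E.HasIntegral f S) (h' : E.HasIntegral g T) :
    E.HasIntegral (fun l => f l - g l) (S - T) := by
  have := h.add hf ((BddMeas.const (-1)).mul hg) (h'.const_mul (-1))
  simpa [sub_eq_add_neg] using this

theorem hasIntegral_indicator {S : Set ℝ} (hS : MeasurableSet S) :
    E.HasIntegral (S.indicator fun _ => (1 : ℂ)) (E.proj S) := fun x => by
  rw [integral_indicator_const _ hS, E.inner_proj x hS]
  simp

/-- The form bound turns uniform differences of functions into operator norm differences, so uniform
approximations yield a Cauchy sequence of operators. -/
theorem exists_hasIntegral {f : ℝ → ℂ} (hf : BddMeas f) : ∃ T, E.HasIntegral f T := by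
  induction hf using BddMeas.induction with
  | hind S hS => exact ⟨_, E.hasIntegral_indicator hS⟩
  | hadd f g hf hg h1 h2 =>
    obtain ⟨S, hS⟩ := h1
    obtain ⟨T, hT⟩ := h2
    exact ⟨_, hS.add hf hg hT⟩
  | hsmul c f hf h =>
    obtain ⟨S, hS⟩ := h
    exact ⟨_, hS.const_mul c⟩
  | hlim f s hf hs hfs h =>
    choose T hT using h
    have hlim0 : Tendsto (fun n : ℕ => 4 * (1 / ((n : ℝ) + 1))) atTop (𝓝 0) := by
      simpa using tendsto_one_div_add_atTop_nhds_zero_nat.const_mul (4 : ℝ)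
    have hc : CauchySeq T := by
      -- The 4 is two approximation errors times the factor 2 of `HasIntegral.norm_le`.
      refine cauchySeq_of_le_tendsto_0' (fun n : ℕ => 4 * (1 / ((n : ℝ) + 1))) ?_ hlim0
      intro n m hnm
      rw [dist_eq_norm]
      refine ((hT n).sub (hs n) (hs m) (hT m)).norm_le (C := 2 * (1 / ((n : ℝ) + 1))) ?_ |>.trans
        (by linarith)
      intro l
      have h1 := hfs n l
      have h2 := hfs m l
      have h3 : 1 / ((m : ℝ) + 1) ≤ 1 / ((n : ℝ) + 1) := by
        apply one_div_le_one_div_of_le (by positivity)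
        exact_mod_cast Nat.succ_le_succ hnm
      calc ‖s n l - s m l‖ = ‖(f l - s m l) - (f l - s n l)‖ := by congr 1; ring
        _ ≤ _ := norm_sub_le _ _
        _ ≤ _ := by linarith
    obtain ⟨T', hT'⟩ := cauchySeq_tendsto_of_complete hc
    refine ⟨T', fun x => ?_⟩
    have t1 : Tendsto (fun n => inner ℂ x (T n x)) atTop (𝓝 (inner ℂ x (T' x))) :=
      ((continuous_const.inner ((ContinuousLinearMap.apply ℂ 𝓗 x).continuous)).tendsto T').comp hT'
    refine tendsto_nhds_unique t1 ?_
    simp only [hT _ x]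
    rw [tendsto_iff_norm_sub_tendsto_zero]
    refine squeeze_zero (fun _ => norm_nonneg _) (fun n => ?_)
      (g := fun n : ℕ => 1 / ((n : ℝ) + 1) * (E.scalarMeasure x).real univ) ?_
    · rw [← integral_sub ((hs n).integrable _) (hf.integrable _)]
      refine norm_integral_le_of_norm_le_const (ae_of_all _ fun l => ?_)
      rw [norm_sub_rev]
      exact hfs n l
    · simpa using tendsto_one_div_add_atTop_nhds_zero_nat.mul_const ((E.scalarMeasure x).real univ)

open Classical in
/-- `∫ f dE` for a bounded Borel function `f`. -/
def integral (f : ℝ → ℂ) : 𝓗 →L[ℂ] 𝓗 :=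
  if h : ∃ T, E.HasIntegral f T then h.choose else 0

theorem hasIntegral_integral {f : ℝ → ℂ} (hf : BddMeas f) : E.HasIntegral f (E.integral f) := by
  have h := E.exists_hasIntegral hf
  rw [integral, dif_pos h]
  exact h.choose_spec

variable {E} in
theorem HasIntegral.unique {f : ℝ → ℂ} {S T : 𝓗 →L[ℂ] 𝓗} (h : E.HasIntegral f S)
    (h' : E.HasIntegral f T) : S = T :=
  clm_ext_of_inner_self fun x => by rw [h x, h' x]

variable {E} in
theorem HasIntegral.integral_eq {f : ℝ → ℂ} {T : 𝓗 →L[ℂ] 𝓗} (hf : BddMeas f)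
    (h : E.HasIntegral f T) : E.integral f = T :=
  (E.hasIntegral_integral hf).unique h

theorem integral_indicator {S : Set ℝ} (hS : MeasurableSet S) :
    E.integral (S.indicator fun _ => (1 : ℂ)) = E.proj S :=
  (E.hasIntegral_indicator hS).integral_eq (BddMeas.indicator hS)

theorem integral_add {f g : ℝ → ℂ} (hf : BddMeas f) (hg : BddMeas g) :
    E.integral (fun l => f l + g l) = E.integral f + E.integral g :=
  ((E.hasIntegral_integral hf).add hf hg (E.hasIntegral_integral hg)).integral_eq (hf.add hg)

theorem integral_sub {f g : ℝ → ℂ} (hf : BddMeas f) (hg : BddMeas g) :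
    E.integral (fun l => f l - g l) = E.integral f - E.integral g :=
  ((E.hasIntegral_integral hf).sub hf hg (E.hasIntegral_integral hg)).integral_eq (hf.sub hg)

theorem integral_const_mul {f : ℝ → ℂ} (hf : BddMeas f) (c : ℂ) :
    E.integral (fun l => c * f l) = c • E.integral f :=
  ((E.hasIntegral_integral hf).const_mul c).integral_eq ((BddMeas.const c).mul hf)

theorem integral_const (c : ℂ) : E.integral (fun _ => c) = c • (1 : 𝓗 →L[ℂ] 𝓗) := by
  have := E.integral_const_mul (BddMeas.indicator MeasurableSet.univ) c
  rw [E.integral_indicator MeasurableSet.univ, E.proj_univ] at this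
  simpa using this

theorem norm_integral_le {f : ℝ → ℂ} (hf : BddMeas f) {C : ℝ} (hC : ∀ l, ‖f l‖ ≤ C) :
    ‖E.integral f‖ ≤ 2 * C :=
  (E.hasIntegral_integral hf).norm_le hC

theorem adjoint_integral {f : ℝ → ℂ} (hf : BddMeas f) :
    star (E.integral f) = E.integral (fun l => starRingEnd ℂ (f l)) := by
  refine (HasIntegral.integral_eq hf.conj fun x => ?_).symm
  rw [ContinuousLinearMap.star_eq_adjoint, ContinuousLinearMap.adjoint_inner_right,
    ← inner_conj_symm, E.hasIntegral_integral hf x, integral_conj]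

theorem tendsto_integral {f : ℝ → ℂ} {s : ℕ → ℝ → ℂ} (hf : BddMeas f)
    (hs : ∀ n, BddMeas (s n)) {c : ℕ → ℝ} (hc : Tendsto c atTop (𝓝 0))
    (h : ∀ n l, ‖f l - s n l‖ ≤ c n) :
    Tendsto (fun n => E.integral (s n)) atTop (𝓝 (E.integral f)) := by
  rw [tendsto_iff_norm_sub_tendsto_zero]
  refine squeeze_zero (fun _ => norm_nonneg _) (g := fun n => 2 * c n) (fun n => ?_)
    (by simpa using hc.const_mul 2)
  rw [norm_sub_rev, ← E.integral_sub hf (hs n)]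
  exact E.norm_integral_le (hf.sub (hs n)) (h n)

/-- Multiplicativity is obtained one factor at a time: the second factor is an indicator here, the
first is built up from `proj_mul`. `integral_mul` then builds up the second. -/
theorem integral_mul_indicator {f : ℝ → ℂ} (hf : BddMeas f) {S : Set ℝ} (hS : MeasurableSet S) :
    E.integral (fun l => f l * S.indicator (fun _ => (1 : ℂ)) l) = E.integral f * E.proj S := by
  induction hf using BddMeas.induction with
  | hind T hT =>
    rw [E.integral_indicator hT, E.proj_mul hT hS, ← E.integral_indicator (hT.inter hS)]
    congr 1
    ext l
    by_cases h1 : l ∈ T <;> by_cases h2 : l ∈ S <;> simp [h1, h2]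
  | hadd f g hf hg h1 h2 =>
    simp only [add_mul]
    rw [E.integral_add (hf.mul (.indicator hS)) (hg.mul (.indicator hS)), h1, h2,
      E.integral_add hf hg, add_mul]
  | hsmul c f hf h =>
    simp only [mul_assoc]
    rw [E.integral_const_mul (hf.mul (.indicator hS)), h, E.integral_const_mul hf, smul_mul_assoc]
  | hlim f s hf hs hfs h =>
    have h0 := tendsto_one_div_add_atTop_nhds_zero_nat (𝕜 := ℝ)
    have t1 := (E.tendsto_integral hf hs h0 hfs).mul_const (E.proj S)
    refine tendsto_nhds_unique (E.tendsto_integral (hf.mul (.indicator hS))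
      (fun n => (hs n).mul (.indicator hS)) h0 fun n l => ?_) (by simpa only [h] using t1)
    by_cases hl : l ∈ S
    · simpa [hl] using hfs n l
    · simp [hl]; positivity

theorem integral_mul {f g : ℝ → ℂ} (hf : BddMeas f) (hg : BddMeas g) :
    E.integral (fun l => f l * g l) = E.integral f * E.integral g := by
  induction hg using BddMeas.induction with
  | hind S hS => rw [E.integral_mul_indicator hf hS, E.integral_indicator hS]
  | hadd g₁ g₂ hg₁ hg₂ h1 h2 =>
    simp only [mul_add]
    rw [E.integral_add (hf.mul hg₁) (hf.mul hg₂), h1, h2, E.integral_add hg₁ hg₂, mul_add]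
  | hsmul c g hg h =>
    simp only [mul_left_comm _ c]
    rw [E.integral_const_mul (hf.mul hg), h, E.integral_const_mul hg, mul_smul_comm]
  | hlim g s hg hs hgs h =>
    have h0 := tendsto_one_div_add_atTop_nhds_zero_nat (𝕜 := ℝ)
    have t1 := (E.tendsto_integral hg hs h0 hgs).const_mul (E.integral f)
    obtain ⟨C, hC⟩ := hf.bdd
    refine tendsto_nhds_unique (E.tendsto_integral (hf.mul hg)
      (fun n => hf.mul (hs n)) (c := fun n : ℕ => C * (1 / ((n : ℝ) + 1)))
      (by simpa using h0.const_mul C) fun n l => ?_)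
      (by simpa only [h] using t1)
    rw [← mul_sub, norm_mul]
    exact mul_le_mul (hC l) (hgs n l) (norm_nonneg _) ((norm_nonneg _).trans (hC l))

theorem inner_integral_integral {f g : ℝ → ℂ} (hf : BddMeas f) (hg : BddMeas g) (x : 𝓗) :
    inner ℂ (E.integral f x) (E.integral g x)
      = ∫ l, starRingEnd ℂ (f l) * g l ∂E.scalarMeasure x := by
  rw [← E.hasIntegral_integral (hf.conj.mul hg) x, E.integral_mul hf.conj hg,
    ← E.adjoint_integral hf, ContinuousLinearMap.star_eq_adjoint]
  simp [ContinuousLinearMap.adjoint_inner_right]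

/-- The map `f ↦ (∫ f dE) x` is isometric for the `L²` norm of the scalar measure, so questions of
strong convergence become dominated convergence. -/
theorem norm_sq_integral {f : ℝ → ℂ} (hf : BddMeas f) (x : 𝓗) :
    ‖E.integral f x‖ ^ 2 = ∫ l, ‖f l‖ ^ 2 ∂E.scalarMeasure x := by
  have h := E.inner_integral_integral hf hf x
  rw [inner_self_eq_norm_sq_to_K] at h
  have h2 : ∀ l, starRingEnd ℂ (f l) * f l = ((‖f l‖ ^ 2 : ℝ) : ℂ) := fun l => by
    rw [mul_comm, Complex.mul_conj, Complex.normSq_eq_norm_sq]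
  simp only [h2] at h
  rw [integral_complex_ofReal] at h
  exact Complex.ofReal_injective (by rw [← h]; simp)

theorem scalarMeasure_integral {f : ℝ → ℂ} (hf : BddMeas f) (x : 𝓗) :
    E.scalarMeasure (E.integral f x)
      = (E.scalarMeasure x).withDensity fun l => (‖f l‖₊ ^ 2 : NNReal) := by
  ext S hS
  have hfi : BddMeas fun l => S.indicator (fun _ => (1 : ℂ)) l * f l := (BddMeas.indicator hS).mul hf
  have e1 : E.proj S (E.integral f x) = E.integral (fun l => S.indicator (fun _ => (1 : ℂ)) l * f l) x := by
    rw [E.integral_mul (.indicator hS) hf, E.integral_indicator hS]; rfl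
  rw [← ENNReal.ofReal_toReal (measure_ne_top (E.scalarMeasure (E.integral f x)) S)]
  change ENNReal.ofReal ((E.scalarMeasure (E.integral f x)).real S) = _
  rw [E.scalarMeasure_real _ hS, e1, E.norm_sq_integral hfi, withDensity_apply _ hS,
    ofReal_integral_eq_lintegral_ofReal ?_ (ae_of_all _ fun _ => by positivity),
    ← lintegral_indicator hS]
  · congr 1
    ext l
    by_cases h : l ∈ S
    · simp only [h, indicator_of_mem, one_mul]
      rw [← ENNReal.ofReal_coe_nnreal]
      simp
    · simp [h]
  · obtain ⟨C, hC⟩ := hfi.bdd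
    refine Integrable.of_bound ((hfi.measurable.norm.pow_const 2).aestronglyMeasurable) (C ^ 2)
      (ae_of_all _ fun l => ?_)
    rw [Real.norm_of_nonneg (by positivity)]
    exact pow_le_pow_left₀ (norm_nonneg _) (hC l) 2

end ProjectionValuedMeasure

/-! ### Resolvents -/

/-- The function `l ↦ (l + σ i)⁻¹`. -/
def res (σ l : ℝ) : ℂ := ((l : ℂ) + σ * Complex.I)⁻¹

theorem add_mul_I_ne_zero {σ : ℝ} (hσ : σ ≠ 0) (l : ℝ) : (l : ℂ) + σ * Complex.I ≠ 0 := fun h =>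
  hσ (by simpa using congrArg Complex.im h)

theorem norm_sq_add_mul_I (σ l : ℝ) : ‖(l : ℂ) + σ * Complex.I‖ ^ 2 = l ^ 2 + σ ^ 2 := by
  rw [← Complex.normSq_eq_norm_sq, Complex.normSq_add_mul_I]

theorem norm_sq_res (σ l : ℝ) : ‖res σ l‖ ^ 2 = (l ^ 2 + σ ^ 2)⁻¹ := by
  rw [res, norm_inv, inv_pow, norm_sq_add_mul_I]

theorem conj_res (σ l : ℝ) : starRingEnd ℂ (res σ l) = res (-σ) l := by
  simp [res]

theorem norm_res_le {σ : ℝ} (hσ : σ ≠ 0) (l : ℝ) : ‖res σ l‖ ≤ |σ|⁻¹ := by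
  refine abs_le_of_sq_le_sq' ?_ (by positivity) |>.2
  rw [norm_sq_res, inv_pow, sq_abs]
  exact inv_anti₀ (by positivity) (by nlinarith [sq_nonneg l])

theorem continuous_res {σ : ℝ} (hσ : σ ≠ 0) : Continuous (res σ) :=
  Continuous.inv₀ (by fun_prop) (add_mul_I_ne_zero hσ)

theorem bddMeas_res {σ : ℝ} (hσ : σ ≠ 0) : BddMeas (res σ) :=
  ⟨(continuous_res hσ).measurable, _, norm_res_le hσ⟩

/-- A linear map on a dense subspace whose quadratic form vanishes is zero. -/
theorem linearMap_eq_zero_of_inner_self {D : Submodule ℂ 𝓗} (hD : Dense (D : Set 𝓗))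
    (T : D →ₗ[ℂ] 𝓗) (h : ∀ u : D, inner ℂ (u : 𝓗) (T u) = 0) (u : D) : T u = 0 := by
  have key : ∀ u v : D, inner ℂ (v : 𝓗) (T u) = 0 := by
    intro u v
    have h1 := h (u + v)
    have h2 := h (u + Complex.I • v)
    simp only [map_add, map_smul, Submodule.coe_add, Submodule.coe_smul, inner_add_left,
      inner_add_right, inner_smul_left, inner_smul_right, h, Complex.conj_I] at h1 h2
    have h3 : inner ℂ (u : 𝓗) (T v) = - inner ℂ (v : 𝓗) (T u) := by linear_combination h1
    rw [h3] at h2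
    have h4 : (2 * Complex.I) * inner ℂ (v : 𝓗) (T u) = 0 := by linear_combination -h2
    exact (mul_eq_zero.mp h4).resolve_left (by simp)
  exact hD.eq_zero_of_inner_right (𝕜 := ℂ) (x := T u) fun v hv => key u ⟨v, hv⟩

/-! ### Resolvents as operator integrals -/

namespace ProjectionValuedMeasure

variable (E : ProjectionValuedMeasure 𝓗)

/-- Pointwise bounded convergence gives strong, not norm, convergence: by the isometry the squared
error is an integral against a finite measure, dominated by a constant. -/
theorem tendsto_integral_apply {f : ℝ → ℂ} {s : ℕ → ℝ → ℂ} (hf : BddMeas f)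
    (hs : ∀ n, BddMeas (s n)) {C : ℝ} (hC : ∀ n l, ‖s n l‖ ≤ C)
    (h : ∀ l, Tendsto (fun n => s n l) atTop (𝓝 (f l))) (x : 𝓗) :
    Tendsto (fun n => E.integral (s n) x) atTop (𝓝 (E.integral f x)) := by
  obtain ⟨D, hD⟩ := hf.bdd
  rw [tendsto_iff_norm_sub_tendsto_zero]
  have t : Tendsto (fun n => ‖E.integral (s n) x - E.integral f x‖ ^ 2) atTop (𝓝 0) := by
    have e : ∀ n, ‖E.integral (s n) x - E.integral f x‖ ^ 2
        = ∫ l, ‖s n l - f l‖ ^ 2 ∂E.scalarMeasure x := fun n => by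
      rw [← E.norm_sq_integral ((hs n).sub hf), E.integral_sub (hs n) hf]; rfl
    simp only [e]
    rw [show (0 : ℝ) = ∫ l, (0 : ℝ) ∂E.scalarMeasure x by simp]
    refine tendsto_integral_of_dominated_convergence (fun _ => (C + D) ^ 2)
      (fun n => (((hs n).sub hf).measurable.norm.pow_const 2).aestronglyMeasurable)
      (integrable_const _) (fun n => ae_of_all _ fun l => ?_) (ae_of_all _ fun l => ?_)
    · rw [Real.norm_of_nonneg (by positivity)]
      exact pow_le_pow_left₀ (norm_nonneg _)
        ((norm_sub_le _ _).trans (add_le_add (hC n l) (hD l))) 2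
    · have := ((h l).sub_const (f l)).norm.pow 2
      simpa using this
  have := t.sqrt
  simpa [Real.sqrt_sq (norm_nonneg _)] using this

theorem tendsto_proj_Icc (x : 𝓗) :
    Tendsto (fun n : ℕ => E.proj (Icc (-(n : ℝ)) n) x) atTop (𝓝 x) := by
  have h := E.tendsto_integral_apply (f := fun _ => 1) (BddMeas.const 1)
    (s := fun n : ℕ => (Icc (-(n : ℝ)) n).indicator fun _ => (1 : ℂ))
    (fun n => BddMeas.indicator measurableSet_Icc) (C := 1) (fun n l => ?_) (fun l => ?_) x
  · simpa only [E.integral_indicator measurableSet_Icc, E.integral_const, one_smul, one_apply_eq_self] using h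
  · by_cases hl : l ∈ Icc (-(n : ℝ)) n <;> simp [hl]
  · refine tendsto_const_nhds.congr' ?_
    obtain ⟨N, hN⟩ := exists_nat_ge |l|
    filter_upwards [eventually_ge_atTop N] with n hn
    have : l ∈ Icc (-(n : ℝ)) n := abs_le.mp (hN.trans (by exact_mod_cast hn))
    simp [this]

/-- Multiplying `res σ` by its inverse truncated to `[-n, n]` gives the indicator of `[-n, n]`. A
vector in the kernel is thus killed by all these projections, which tend strongly to the identity.
-/
theorem integral_res_injective {σ : ℝ} (hσ : σ ≠ 0) :
    Function.Injective (E.integral (res σ)) := by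
  rw [injective_iff_map_eq_zero]
  intro y hy
  have h : ∀ n : ℕ, E.proj (Icc (-(n : ℝ)) n) y = 0 := by
    intro n
    have hb : BddMeas fun l : ℝ => (Icc (-(n : ℝ)) n).indicator
        (fun l : ℝ => (l : ℂ) + σ * Complex.I) l := by
      refine ⟨(by fun_prop : Measurable fun l : ℝ => (l : ℂ) + σ * Complex.I).indicator
        measurableSet_Icc, n + |σ|, fun l => ?_⟩
      by_cases hl : l ∈ Icc (-(n : ℝ)) n
      · rw [indicator_of_mem hl]
        refine (norm_add_le _ _).trans (add_le_add ?_ (by simp))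
        simpa using abs_le.mpr hl
      · rw [indicator_of_notMem hl]; simp; positivity
    have := E.integral_mul hb (bddMeas_res hσ)
    have e : (fun l : ℝ => (Icc (-(n : ℝ)) n).indicator
        (fun l : ℝ => (l : ℂ) + σ * Complex.I) l * res σ l)
        = (Icc (-(n : ℝ)) n).indicator fun _ => (1 : ℂ) := by
      ext l
      by_cases hl : l ∈ Icc (-(n : ℝ)) n
      · simp [hl, res, add_mul_I_ne_zero hσ l]
      · simp [hl]
    rw [e, E.integral_indicator measurableSet_Icc] at this
    rw [this, mul_apply_eq_comp, hy, map_zero]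
  have t := E.tendsto_proj_Icc y
  simp only [h] at t
  exact (tendsto_nhds_unique t tendsto_const_nhds)

/-- The scalar measure acquires the density `1 / (l² + σ²)`, against which `l²` is bounded by 1. -/
theorem integrable_sq_scalarMeasure_res {σ : ℝ} (hσ : σ ≠ 0) (y : 𝓗) :
    Integrable (fun l : ℝ => l ^ 2) (E.scalarMeasure (E.integral (res σ) y)) := by
  rw [E.scalarMeasure_integral (bddMeas_res hσ), integrable_withDensity_iff_integrable_coe_smul
    ((bddMeas_res hσ).measurable.nnnorm.pow_const 2)]
  refine Integrable.of_bound ?_ 1 (ae_of_all _ fun l => ?_)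
  · exact (((bddMeas_res hσ).measurable.nnnorm.pow_const 2).coe_nnreal_real.smul
      (by fun_prop)).aestronglyMeasurable
  · simp only [NNReal.coe_pow, coe_nnnorm, norm_sq_res, smul_eq_mul]
    have : 0 < l ^ 2 + σ ^ 2 := by positivity
    rw [Real.norm_of_nonneg (by positivity), inv_mul_le_iff₀ this]
    nlinarith [sq_nonneg σ]

/-- For `x = E.integral (res σ) y` the vector `y - σ i x` is the candidate for `A x`, since `1 - σ i
/ (l + σ i) = l / (l + σ i)`. -/
theorem inner_integral_res {σ : ℝ} (hσ : σ ≠ 0) (y : 𝓗) :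
    inner ℂ (E.integral (res σ) y) (y - (σ * Complex.I : ℂ) • E.integral (res σ) y)
      = ((∫ l, l ∂E.scalarMeasure (E.integral (res σ) y) : ℝ) : ℂ) := by
  have hr := bddMeas_res hσ
  have e : y - (σ * Complex.I : ℂ) • E.integral (res σ) y
      = E.integral (fun l => 1 - (σ * Complex.I) * res σ l) y := by
    rw [E.integral_sub (BddMeas.const 1) ((BddMeas.const _).mul hr), E.integral_const_mul hr,
      E.integral_const]
    simp
  rw [e, E.inner_integral_integral hr ((BddMeas.const 1).sub ((BddMeas.const _).mul hr)),
    E.scalarMeasure_integral hr, integral_withDensity_eq_integral_smul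
      (hr.measurable.nnnorm.pow_const 2), ← integral_complex_ofReal]
  congr 1
  ext l
  have h1 := add_mul_I_ne_zero hσ l
  have h2 : starRingEnd ℂ (res σ l) * res σ l = ((‖res σ l‖ ^ 2 : ℝ) : ℂ) := by
    rw [mul_comm, Complex.mul_conj, Complex.normSq_eq_norm_sq]
  have h3 : 1 - (σ * Complex.I) * res σ l = l * res σ l := by
    rw [res]; field_simp; ring
  rw [h3, mul_left_comm, h2, NNReal.smul_def]
  simp [mul_comm]

/-- The preimage is the limit of the integrals of `l + σ i` over `[-n, n]` applied to `x`; they form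
a Cauchy sequence because the tails of the second moment vanish. -/
theorem exists_integral_res_eq {σ : ℝ} (hσ : σ ≠ 0) {x : 𝓗}
    (hx : Integrable (fun l : ℝ => l ^ 2) (E.scalarMeasure x)) :
    ∃ y, E.integral (res σ) y = x := by
  set I : ℕ → Set ℝ := fun n => Icc (-(n : ℝ)) n with hI
  set g : ℕ → ℝ → ℂ := fun n => (I n).indicator fun l : ℝ => (l : ℂ) + σ * Complex.I with hg
  have hIm : ∀ n, MeasurableSet (I n) := fun n => measurableSet_Icc
  have hb : ∀ n, BddMeas (g n) := by
    intro n
    refine ⟨(by fun_prop : Measurable fun l : ℝ => (l : ℂ) + σ * Complex.I).indicator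
        (hIm n), n + |σ|, fun l => ?_⟩
    by_cases hl : l ∈ I n
    · rw [hg]
      simp only [indicator_of_mem hl]
      refine (norm_add_le _ _).trans (add_le_add ?_ (by simp))
      simpa using abs_le.mpr hl
    · rw [hg]
      simp only [indicator_of_notMem hl]
      simp; positivity
  have hx' : Integrable (fun l : ℝ => l ^ 2 + σ ^ 2) (E.scalarMeasure x) :=
    hx.add (integrable_const _)
  set t : ℕ → ℝ := fun n => ∫ l, (I n)ᶜ.indicator (fun l : ℝ => l ^ 2 + σ ^ 2) l ∂E.scalarMeasure x
  have ht : Tendsto t atTop (𝓝 0) := by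
    rw [show (0 : ℝ) = ∫ l, (0 : ℝ) ∂E.scalarMeasure x by simp]
    refine tendsto_integral_of_dominated_convergence (fun l => l ^ 2 + σ ^ 2)
      (fun n => (hx'.indicator (hIm n).compl).aestronglyMeasurable) hx'
      (fun n => ae_of_all _ fun l => ?_) (ae_of_all _ fun l => ?_)
    · rw [norm_indicator_eq_indicator_norm]
      refine (indicator_le_self' (fun _ _ => norm_nonneg _) l).trans ?_
      rw [Real.norm_of_nonneg (by positivity)]
    · refine tendsto_const_nhds.congr' ?_
      obtain ⟨N, hN⟩ := exists_nat_ge |l|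
      filter_upwards [eventually_ge_atTop N] with n hn
      have : l ∈ I n := abs_le.mp (hN.trans (by exact_mod_cast hn))
      simp [this]
  have hc : CauchySeq fun n => E.integral (g n) x := by
    refine cauchySeq_of_le_tendsto_0' (fun n => √(t n)) (fun n m hnm => ?_)
      (by simpa using ht.sqrt)
    rw [dist_comm, dist_eq_norm]
    apply Real.le_sqrt_of_sq_le
    have e : E.integral (g m) x - E.integral (g n) x = E.integral (fun l => g m l - g n l) x := by
      rw [E.integral_sub (hb m) (hb n)]; rfl
    rw [e, E.norm_sq_integral ((hb m).sub (hb n))]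
    refine integral_mono_of_nonneg (ae_of_all _ fun l => by positivity)
      (hx'.indicator (hIm n).compl) (ae_of_all _ fun l => ?_)
    by_cases hn : l ∈ I n
    · have hm : l ∈ I m := Icc_subset_Icc (by simpa using hnm) (by simpa using hnm) hn
      simp [hg, hn, hm]
    · by_cases hm : l ∈ I m
      · simp [hg, hn, hm, norm_sq_add_mul_I]
      · simp [hg, hn, hm]
        positivity
  obtain ⟨y, hy⟩ := cauchySeq_tendsto_of_complete hc
  refine ⟨y, tendsto_nhds_unique (((E.integral (res σ)).continuous.tendsto y).comp hy) ?_⟩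
  refine (E.tendsto_proj_Icc x).congr fun n => ?_
  have := E.integral_mul (bddMeas_res hσ) (hb n)
  have e : (fun l : ℝ => res σ l * g n l) = (I n).indicator fun _ => (1 : ℂ) := by
    ext l
    by_cases hl : l ∈ I n
    · simp [hg, hl, res, add_mul_I_ne_zero hσ l]
    · simp [hg, hl]
  rw [e, E.integral_indicator (hIm n)] at this
  exact congrArg (fun T : 𝓗 →L[ℂ] 𝓗 => T x) this

end ProjectionValuedMeasure

/-- The integral of `res 1` maps onto exactly the vectors of finite second moment. Once it inverts
`A + i`, both the domain and the quadratic form of `A` are therefore the prescribed ones. -/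
theorem isSpectralMeasure_of_integral_res {E : ProjectionValuedMeasure 𝓗} {A : 𝓗 →ₗ.[ℂ] 𝓗}
    (h1 : ∀ u : A.domain, E.integral (res 1) (A u + Complex.I • (u : 𝓗)) = u)
    (h2 : ∀ y, E.integral (res 1) y ∈ A.domain) : IsSpectralMeasure E A := by
  refine ⟨fun x => ⟨fun hx => ?_, fun hx => ?_⟩, fun x => ?_⟩
  · have := E.integrable_sq_scalarMeasure_res one_ne_zero (A ⟨x, hx⟩ + Complex.I • x)
    rwa [h1 ⟨x, hx⟩] at this
  · obtain ⟨y, rfl⟩ := E.exists_integral_res_eq one_ne_zero hx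
    exact h2 y
  · have := E.inner_integral_res one_ne_zero (A x + Complex.I • (x : 𝓗))
    rw [h1] at this
    simpa using this

variable {E : ProjectionValuedMeasure 𝓗} {A : 𝓗 →ₗ.[ℂ] 𝓗}

/-- `IsSpectralMeasure` prescribes only the quadratic form of `A`. If `Y u` is the preimage of `u`
under the integral of `res σ`, then `u ↦ Y u - σ i u - A u` is linear (by injectivity) with
vanishing form on a dense domain, hence zero. -/
theorem IsSpectralMeasure.integral_res_apply (h : IsSpectralMeasure E A)
    (hd : Dense (A.domain : Set 𝓗)) {σ : ℝ} (hσ : σ ≠ 0) (u : A.domain) :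
    E.integral (res σ) (A u + (σ * Complex.I : ℂ) • (u : 𝓗)) = u := by
  choose Y hY using fun u : A.domain => E.exists_integral_res_eq hσ ((h.1 u).mp u.2)
  have hinj := E.integral_res_injective hσ
  let Yl : A.domain →ₗ[ℂ] 𝓗 :=
    { toFun := Y
      map_add' := fun u v => hinj (by simp [hY])
      map_smul' := fun c u => hinj (by simp [hY]) }
  let T : A.domain →ₗ[ℂ] 𝓗 := Yl - (σ * Complex.I : ℂ) • A.domain.subtype - A.toFun
  have hT : T u = 0 := by
    refine linearMap_eq_zero_of_inner_self hd T (fun v => ?_) u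
    have e : T v = (Y v - (σ * Complex.I : ℂ) • (v : 𝓗)) - A v := rfl
    have := E.inner_integral_res hσ (Y v)
    rw [hY] at this
    rw [e, inner_sub_right, this, h.2 v, sub_self]
  have e : (Y u - (σ * Complex.I : ℂ) • (u : 𝓗)) - A u = 0 := hT
  rw [sub_eq_zero, sub_eq_iff_eq_add] at e
  rw [← e, hY]

theorem IsSpectralMeasure.exists_domain (h : IsSpectralMeasure E A)
    (hd : Dense (A.domain : Set 𝓗)) {σ : ℝ} (hσ : σ ≠ 0) (y : 𝓗) :
    ∃ u : A.domain, A u + (σ * Complex.I : ℂ) • (u : 𝓗) = y := by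
  refine ⟨⟨E.integral (res σ) y, (h.1 _).mpr (E.integrable_sq_scalarMeasure_res hσ y)⟩, ?_⟩
  apply E.integral_res_injective hσ
  rw [h.integral_res_apply hd hσ]

/-! ### Projection-valued measures from representations of `C(X)` -/

section Representation

variable {X : Type*} [MetricSpace X] [CompactSpace X] [MeasurableSpace X] [BorelSpace X]

/-- A real continuous function viewed as a complex one. -/
def liftReal (f : C(X, ℝ)) : C(X, ℂ) := ⟨fun w => (f w : ℂ), by fun_prop⟩

@[simp] theorem liftReal_apply (f : C(X, ℝ)) (w : X) : liftReal f w = (f w : ℂ) := rfl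

theorem liftReal_add (f g : C(X, ℝ)) : liftReal (f + g) = liftReal f + liftReal g := by
  ext; simp

theorem liftReal_sub (f g : C(X, ℝ)) : liftReal (f - g) = liftReal f - liftReal g := by
  ext; simp

theorem liftReal_smul (c : ℝ) (f : C(X, ℝ)) : liftReal (c • f) = (c : ℂ) • liftReal f := by
  ext; simp

theorem star_liftReal (f : C(X, ℝ)) : star (liftReal f) = liftReal f := by
  ext; simp

variable (Ψ : C(X, ℂ) →⋆ₐ[ℂ] (𝓗 →L[ℂ] 𝓗))

theorem inner_map_star (g h : C(X, ℂ)) (x : 𝓗) :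
    inner ℂ (Ψ g x) (Ψ h x) = inner ℂ x (Ψ (star g * h) x) := by
  rw [map_mul, map_star, ContinuousLinearMap.star_eq_adjoint, mul_apply_eq_comp,
    ContinuousLinearMap.adjoint_inner_right]

theorem re_inner_liftReal_nonneg {f : C(X, ℝ)} (hf : ∀ w, 0 ≤ f w) (x : 𝓗) :
    0 ≤ (inner ℂ x (Ψ (liftReal f) x)).re := by
  let g : C(X, ℝ) := ⟨fun w => √(f w), by fun_prop⟩
  have : liftReal f = star (liftReal g) * liftReal g := by
    ext w
    simp only [liftReal_apply, ContinuousMap.mul_apply, star_liftReal]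
    rw [← Complex.ofReal_mul]
    simp [g, Real.mul_self_sqrt (hf w)]
  rw [this, ← inner_map_star]
  exact inner_self_nonneg (𝕜 := ℂ)

/-- The positive functional `f ↦ ⟨x, Ψ(f) x⟩`. -/
def vectorState (x : 𝓗) : CompactlySupportedContinuousMap X ℝ →ₚ[ℝ] ℝ :=
  PositiveLinearMap.mk₀
    { toFun := fun f => (inner ℂ x (Ψ (liftReal f.toContinuousMap) x)).re
      map_add' := fun f g => by
        have : liftReal (f + g).toContinuousMap
          = liftReal f.toContinuousMap + liftReal g.toContinuousMap := liftReal_add _ _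
        rw [this, map_add, add_apply, inner_add_right, Complex.add_re]
      map_smul' := fun c f => by
        have : liftReal (c • f).toContinuousMap = (c : ℂ) • liftReal f.toContinuousMap :=
          liftReal_smul _ _
        rw [this, map_smul, smul_apply, inner_smul_right]
        simp }
    fun f hf => re_inner_liftReal_nonneg Ψ (fun w => hf w) x

/-- The measure representing `f ↦ ⟨x, Ψ(f) x⟩`. -/
def vectorMeasure (x : 𝓗) : Measure X := RealRMK.rieszMeasure (vectorState Ψ x)

instance (x : 𝓗) : IsFiniteMeasure (vectorMeasure Ψ x) := by
  unfold vectorMeasure; infer_instance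

theorem continuousMap_integrable {F : Type*} [NormedAddCommGroup F]
    (f : C(X, F)) (m : Measure X) [IsFiniteMeasure m] : Integrable f m :=
  f.continuous.integrable_of_hasCompactSupport (HasCompactSupport.of_compactSpace f)

theorem inner_liftReal (f : C(X, ℝ)) (x : 𝓗) :
    inner ℂ x (Ψ (liftReal f) x) = ((∫ w, f w ∂vectorMeasure Ψ x : ℝ) : ℂ) := by
  have h := RealRMK.integral_rieszMeasure (vectorState Ψ x)
    ⟨f, HasCompactSupport.of_compactSpace f⟩
  have h' : ∫ w, f w ∂vectorMeasure Ψ x = (inner ℂ x (Ψ (liftReal f) x)).re := h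
  rw [h']
  have hs : starRingEnd ℂ (inner ℂ x (Ψ (liftReal f) x)) = inner ℂ x (Ψ (liftReal f) x) := by
    rw [inner_conj_symm]
    conv_lhs => rw [← star_liftReal f, map_star, ContinuousLinearMap.star_eq_adjoint,
      ContinuousLinearMap.adjoint_inner_left]
  exact (Complex.conj_eq_iff_re.mp hs).symm

theorem inner_eq_integral (f : C(X, ℂ)) (x : 𝓗) :
    inner ℂ x (Ψ f x) = ∫ w, f w ∂vectorMeasure Ψ x := by
  let a : C(X, ℝ) := ⟨fun w => (f w).re, by fun_prop⟩
  let b : C(X, ℝ) := ⟨fun w => (f w).im, by fun_prop⟩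
  have hf : f = liftReal a + Complex.I • liftReal b := by
    ext w
    simp only [ContinuousMap.add_apply, ContinuousMap.smul_apply, liftReal_apply, smul_eq_mul]
    rw [mul_comm]
    exact (Complex.re_add_im (f w)).symm
  have hi : ∀ w, f w = (a w : ℂ) + Complex.I * (b w : ℂ) := fun w => by
    rw [mul_comm]; exact (Complex.re_add_im (f w)).symm
  conv_lhs => rw [hf, map_add, map_smul, add_apply, smul_apply, inner_add_right,
    inner_smul_right, inner_liftReal, inner_liftReal]
  have ha : Integrable (fun w => (a w : ℂ)) (vectorMeasure Ψ x) :=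
    continuousMap_integrable (liftReal a) _
  have hb : Integrable (fun w => (b w : ℂ)) (vectorMeasure Ψ x) :=
    continuousMap_integrable (liftReal b) _
  simp only [hi]
  rw [integral_add ha (hb.const_mul _), integral_const_mul, integral_complex_ofReal,
    integral_complex_ofReal]

theorem norm_sq_liftReal (f : C(X, ℝ)) (x : 𝓗) :
    ‖Ψ (liftReal f) x‖ ^ 2 = ∫ w, f w ^ 2 ∂vectorMeasure Ψ x := by
  have h := inner_map_star Ψ (liftReal f) (liftReal f) x
  have e : star (liftReal f) * liftReal f = liftReal (f ^ 2) := by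
    ext w; simp [star_liftReal, sq]
  rw [e, inner_liftReal, inner_self_eq_norm_sq_to_K] at h
  refine Complex.ofReal_injective ?_
  simpa using h

theorem vectorMeasure_real_univ (x : 𝓗) : (vectorMeasure Ψ x).real univ = ‖x‖ ^ 2 := by
  have h := norm_sq_liftReal Ψ 1 x
  have e : liftReal (1 : C(X, ℝ)) = 1 := by ext; simp
  rw [e, map_one] at h
  simpa using h.symm

/-- The `L¹` distance of `f` to the indicator of `S`. -/
def cutError (m : Measure X) (S : Set X) (f : C(X, ℝ)) : ℝ :=
  ∫ w, |f w - S.indicator (fun _ => (1 : ℝ)) w| ∂m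

theorem integrable_cutError (m : Measure X) [IsFiniteMeasure m] {S : Set X} (hS : MeasurableSet S)
    (f : C(X, ℝ)) : Integrable (fun w => f w - S.indicator (fun _ => (1 : ℝ)) w) m :=
  (continuousMap_integrable f m).sub ((integrable_const 1).indicator hS)

theorem cutError_mono {m m' : Measure X} [IsFiniteMeasure m'] (h : m ≤ m') {S : Set X}
    (hS : MeasurableSet S) (f : C(X, ℝ)) : cutError m S f ≤ cutError m' S f :=
  integral_mono_measure h (ae_of_all _ fun _ => abs_nonneg _) (integrable_cutError m' hS f).abs

/-- Continuous functions are dense in `L¹`, and clamping to `[0, 1]` does not increase the distance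
to an indicator. -/
theorem exists_cutError_le (m : Measure X) [IsFiniteMeasure m] {S : Set X} (hS : MeasurableSet S)
    {ε : ℝ} (hε : 0 < ε) :
    ∃ f : C(X, ℝ), (∀ w, 0 ≤ f w ∧ f w ≤ 1) ∧ cutError m S f ≤ ε := by
  have hint : Integrable (S.indicator fun _ => (1 : ℝ)) m := (integrable_const 1).indicator hS
  obtain ⟨g, hg, hgi⟩ := hint.exists_boundedContinuous_integral_sub_le hε
  refine ⟨⟨fun w => max 0 (min 1 (g w)), by fun_prop⟩, fun w => ⟨le_max_left _ _, ?_⟩, ?_⟩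
  · simp
  · refine (integral_mono (integrable_cutError m hS _).abs (hint.sub hgi).norm fun w => ?_).trans hg
    simp only [ContinuousMap.coe_mk, Pi.sub_apply, Real.norm_eq_abs]
    rw [abs_sub_comm (S.indicator _ w)]
    have h0 : 0 ≤ S.indicator (fun _ => (1 : ℝ)) w := indicator_nonneg (fun _ _ => zero_le_one) w
    have h1 : S.indicator (fun _ => (1 : ℝ)) w ≤ 1 :=
      indicator_le_self' (f := fun _ => (1 : ℝ)) (fun _ _ => zero_le_one) w
    set s := S.indicator (fun _ => (1 : ℝ)) w
    rcases le_total (g w) 0 with h | h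
    · rw [min_eq_right (by linarith), max_eq_left h, abs_of_nonpos (by linarith),
        abs_of_nonpos (by linarith)]
      linarith
    · rcases le_total (g w) 1 with h' | h'
      · rw [min_eq_right h', max_eq_right h]
      · rw [min_eq_left h', max_eq_right zero_le_one, abs_of_nonneg (by linarith),
          abs_of_nonneg (by linarith)]
        linarith

/-- Sequences of continuous functions with values in `[0, 1]` that converge to the indicator of `S`
in `L¹(m)`. -/
def IsCut (m : Measure X) (S : Set X) (f : ℕ → C(X, ℝ)) : Prop :=
  (∀ n w, 0 ≤ f n w ∧ f n w ≤ 1) ∧ Tendsto (fun n => cutError m S (f n)) atTop (𝓝 0)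

theorem IsCut.mono {m m' : Measure X} [IsFiniteMeasure m'] (h : m ≤ m') {S : Set X}
    (hS : MeasurableSet S) {f : ℕ → C(X, ℝ)} (hf : IsCut m' S f) : IsCut m S f :=
  ⟨hf.1, squeeze_zero (fun _ => integral_nonneg fun _ => abs_nonneg _)
    (fun n => cutError_mono h hS (f n)) hf.2⟩

theorem exists_isCut (m : Measure X) [IsFiniteMeasure m] {S : Set X} (hS : MeasurableSet S) :
    ∃ f, IsCut m S f := by
  choose f h1 h2 using fun n : ℕ =>
    exists_cutError_le m hS (Nat.one_div_pos_of_nat (α := ℝ) (n := n))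
  exact ⟨f, h1, squeeze_zero (fun _ => integral_nonneg fun _ => abs_nonneg _) h2
    tendsto_one_div_add_atTop_nhds_zero_nat⟩

/-- For values in `[0, 1]` the squared difference is at most the absolute difference, so `L¹`
approximation controls the vectors. -/
theorem norm_sq_sub_le_cutError {S : Set X} (hS : MeasurableSet S) {f g : C(X, ℝ)}
    (hf : ∀ w, 0 ≤ f w ∧ f w ≤ 1) (hg : ∀ w, 0 ≤ g w ∧ g w ≤ 1) (x : 𝓗) :
    ‖Ψ (liftReal f) x - Ψ (liftReal g) x‖ ^ 2
      ≤ cutError (vectorMeasure Ψ x) S f + cutError (vectorMeasure Ψ x) S g := by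
  have e : Ψ (liftReal f) x - Ψ (liftReal g) x = Ψ (liftReal (f - g)) x := by
    rw [liftReal_sub, map_sub]; rfl
  have if' := (integrable_cutError (vectorMeasure Ψ x) hS f).abs
  have ig' := (integrable_cutError (vectorMeasure Ψ x) hS g).abs
  rw [e, norm_sq_liftReal, cutError, cutError, ← integral_add if' ig']
  refine integral_mono (continuousMap_integrable ((f - g) ^ 2) _) (if'.add ig') fun w => ?_
  simp only [ContinuousMap.sub_apply]
  set s := S.indicator (fun _ => (1 : ℝ)) w
  have h1 : |f w - g w| ≤ 1 := abs_le.mpr ⟨by linarith [(hf w).1, (hg w).2],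
    by linarith [(hf w).2, (hg w).1]⟩
  have h2 : |f w - g w| ≤ |f w - s| + |g w - s| := by
    rw [abs_sub_comm (g w)]; exact abs_sub_le _ _ _
  calc (f w - g w) ^ 2 = |f w - g w| * |f w - g w| := by rw [← sq, sq_abs]
    _ ≤ 1 * |f w - g w| := mul_le_mul_of_nonneg_right h1 (abs_nonneg _)
    _ ≤ _ := by rw [one_mul]; exact h2

/-- The limit is the same for every approximating sequence; this later allows a single sequence to
serve several vectors at once. -/
theorem exists_tendsto_of_isCut {S : Set X} (hS : MeasurableSet S) (x : 𝓗) :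
    ∃ z, ∀ f, IsCut (vectorMeasure Ψ x) S f →
      Tendsto (fun n => Ψ (liftReal (f n)) x) atTop (𝓝 z) := by
  obtain ⟨f, hf⟩ := exists_isCut (vectorMeasure Ψ x) hS
  have hc : CauchySeq fun n => Ψ (liftReal (f n)) x := by
    rw [Metric.cauchySeq_iff']
    intro ε hε
    have h0 := (tendsto_order.1 hf.2).2 (ε ^ 2 / 2) (by positivity)
    obtain ⟨N, hN⟩ := eventually_atTop.mp h0
    refine ⟨N, fun n hn => ?_⟩
    rw [dist_eq_norm]
    refine lt_of_pow_lt_pow_left₀ 2 hε.le ?_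
    refine (norm_sq_sub_le_cutError Ψ hS (hf.1 n) (hf.1 N) x).trans_lt ?_
    linarith [hN n hn, hN N le_rfl]
  obtain ⟨z, hz⟩ := cauchySeq_tendsto_of_complete hc
  refine ⟨z, fun g hg => ?_⟩
  have h1 : Tendsto (fun n => Ψ (liftReal (g n)) x - Ψ (liftReal (f n)) x) atTop (𝓝 0) := by
    rw [tendsto_zero_iff_norm_tendsto_zero]
    have h2 : Tendsto (fun n => ‖Ψ (liftReal (g n)) x - Ψ (liftReal (f n)) x‖ ^ 2) atTop (𝓝 0) :=
      squeeze_zero (fun _ => by positivity)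
        (fun n => norm_sq_sub_le_cutError Ψ hS (hg.1 n) (hf.1 n) x) (by simpa using hg.2.add hf.2)
    have := h2.sqrt
    simpa [Real.sqrt_sq (norm_nonneg _)] using this
  simpa using h1.add hz

open Classical in
/-- The spectral projection of a Borel set, applied to a vector. -/
def cutFun (S : Set X) (x : 𝓗) : 𝓗 :=
  if hS : MeasurableSet S then (exists_tendsto_of_isCut Ψ hS x).choose else 0

theorem tendsto_cutFun {S : Set X} (hS : MeasurableSet S) {x : 𝓗} {f : ℕ → C(X, ℝ)}
    (hf : IsCut (vectorMeasure Ψ x) S f) :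
    Tendsto (fun n => Ψ (liftReal (f n)) x) atTop (𝓝 (cutFun Ψ S x)) := by
  rw [cutFun, dif_pos hS]
  exact (exists_tendsto_of_isCut Ψ hS x).choose_spec f hf

theorem tendsto_integral_of_isCut {m : Measure X} [IsFiniteMeasure m] {S : Set X}
    (hS : MeasurableSet S) {f : ℕ → C(X, ℝ)} (hf : IsCut m S f) :
    Tendsto (fun n => ∫ w, f n w ∂m) atTop (𝓝 (m.real S)) := by
  rw [tendsto_iff_norm_sub_tendsto_zero]
  refine squeeze_zero (fun _ => norm_nonneg _) (fun n => ?_) hf.2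
  have e : m.real S = ∫ w, S.indicator (fun _ => (1 : ℝ)) w ∂m := by
    rw [integral_indicator_const _ hS]; simp
  rw [e, ← integral_sub (continuousMap_integrable (f n) m) ((integrable_const 1).indicator hS)]
  exact norm_integral_le_integral_norm _

theorem tendsto_integral_sq_of_isCut {m : Measure X} [IsFiniteMeasure m] {S : Set X}
    (hS : MeasurableSet S) {f : ℕ → C(X, ℝ)} (hf : IsCut m S f) :
    Tendsto (fun n => ∫ w, f n w ^ 2 ∂m) atTop (𝓝 (m.real S)) := by
  have hf2 : IsCut m S fun n => f n ^ 2 := by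
    refine ⟨fun n w => ⟨sq_nonneg (f n w), pow_le_one₀ (hf.1 n w).1 (hf.1 n w).2⟩, ?_⟩
    refine squeeze_zero (fun _ => integral_nonneg fun _ => abs_nonneg _)
      -- On `[0, 1]` one has `1 - a² ≤ 2 (1 - a)` and `a² ≤ 2 a`, for points inside and outside `S`.
      (g := fun n => 2 * cutError m S (f n)) (fun n => ?_) (by simpa using hf.2.const_mul 2)
    rw [cutError, cutError, ← integral_const_mul]
    refine integral_mono (integrable_cutError m hS (f n ^ 2)).abs
      ((integrable_cutError m hS (f n)).abs.const_mul 2) fun w => ?_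
    obtain ⟨h0, h1⟩ := hf.1 n w
    simp only [ContinuousMap.pow_apply]
    by_cases hw : w ∈ S
    · simp only [hw, indicator_of_mem]
      rw [abs_of_nonpos (by nlinarith), abs_of_nonpos (by linarith)]
      nlinarith
    · simp only [hw, not_false_eq_true, indicator_of_notMem, sub_zero]
      rw [abs_of_nonneg (by positivity), abs_of_nonneg h0]
      nlinarith
  exact tendsto_integral_of_isCut hS hf2

theorem norm_sq_cutFun {S : Set X} (hS : MeasurableSet S) (x : 𝓗) :
    ‖cutFun Ψ S x‖ ^ 2 = (vectorMeasure Ψ x).real S := by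
  obtain ⟨f, hf⟩ := exists_isCut (vectorMeasure Ψ x) hS
  refine tendsto_nhds_unique ((tendsto_cutFun Ψ hS hf).norm.pow 2) ?_
  simpa only [norm_sq_liftReal] using tendsto_integral_sq_of_isCut hS hf

theorem inner_cutFun {S : Set X} (hS : MeasurableSet S) (x : 𝓗) :
    inner ℂ x (cutFun Ψ S x) = ((vectorMeasure Ψ x).real S : ℂ) := by
  obtain ⟨f, hf⟩ := exists_isCut (vectorMeasure Ψ x) hS
  refine tendsto_nhds_unique (tendsto_const_nhds.inner (tendsto_cutFun Ψ hS hf)) ?_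
  simp only [inner_liftReal]
  exact (Complex.continuous_ofReal.tendsto _).comp (tendsto_integral_of_isCut hS hf)

theorem cutFun_add {S : Set X} (hS : MeasurableSet S) (x y : 𝓗) :
    cutFun Ψ S (x + y) = cutFun Ψ S x + cutFun Ψ S y := by
  set a := vectorMeasure Ψ x
  set b := vectorMeasure Ψ y
  set c := vectorMeasure Ψ (x + y)
  -- Approximation in `L¹` of the sum of the measures is approximation for each of them, so one
  -- sequence computes all three vectors.
  obtain ⟨f, hf⟩ := exists_isCut (a + b + c) hS
  have ha := tendsto_cutFun Ψ hS (hf.mono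
    ((Measure.le_add_right le_rfl : a ≤ a + b).trans (Measure.le_add_right le_rfl)) hS)
  have hb := tendsto_cutFun Ψ hS (hf.mono
    ((Measure.le_add_left le_rfl : b ≤ a + b).trans (Measure.le_add_right le_rfl)) hS)
  have hc := tendsto_cutFun Ψ hS (hf.mono (Measure.le_add_left le_rfl : c ≤ a + b + c) hS)
  refine tendsto_nhds_unique hc ?_
  simpa only [map_add] using ha.add hb

theorem cutFun_smul {S : Set X} (hS : MeasurableSet S) (k : ℂ) (x : 𝓗) :
    cutFun Ψ S (k • x) = k • cutFun Ψ S x := by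
  obtain ⟨f, hf⟩ := exists_isCut (vectorMeasure Ψ x + vectorMeasure Ψ (k • x)) hS
  have ha := tendsto_cutFun Ψ hS (hf.mono (Measure.le_add_right le_rfl) hS)
  have hc := tendsto_cutFun Ψ hS (hf.mono (Measure.le_add_left le_rfl) hS)
  refine tendsto_nhds_unique hc ?_
  simpa only [map_smul] using ha.const_smul k

open Classical in
/-- The spectral projection of a Borel set. -/
def cutProj (S : Set X) : 𝓗 →L[ℂ] 𝓗 :=
  if hS : MeasurableSet S then
    LinearMap.mkContinuous
      { toFun := cutFun Ψ S
        map_add' := cutFun_add Ψ hS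
        map_smul' := cutFun_smul Ψ hS } 1 fun x => by
        rw [one_mul]
        refine le_of_sq_le_sq ?_ (norm_nonneg _)
        change ‖cutFun Ψ S x‖ ^ 2 ≤ _
        rw [norm_sq_cutFun Ψ hS, ← vectorMeasure_real_univ Ψ x]
        exact measureReal_mono (subset_univ S)
  else 0

theorem cutProj_apply {S : Set X} (hS : MeasurableSet S) (x : 𝓗) :
    cutProj Ψ S x = cutFun Ψ S x := by
  rw [cutProj, dif_pos hS]; rfl

theorem inner_cutProj {S : Set X} (hS : MeasurableSet S) (x : 𝓗) :
    inner ℂ x (cutProj Ψ S x) = ((vectorMeasure Ψ x).real S : ℂ) := by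
  rw [cutProj_apply Ψ hS, inner_cutFun Ψ hS]

theorem norm_sq_cutProj {S : Set X} (hS : MeasurableSet S) (x : 𝓗) :
    ‖cutProj Ψ S x‖ ^ 2 = (vectorMeasure Ψ x).real S := by
  rw [cutProj_apply Ψ hS, norm_sq_cutFun Ψ hS]

theorem isStarProjection_cutProj {S : Set X} (hS : MeasurableSet S) :
    IsStarProjection (cutProj Ψ S) := by
  have hsa : star (cutProj Ψ S) = cutProj Ψ S := by
    refine clm_ext_of_inner_self fun x => ?_
    rw [ContinuousLinearMap.star_eq_adjoint, ContinuousLinearMap.adjoint_inner_right,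
      ← inner_conj_symm, inner_cutProj Ψ hS, Complex.conj_ofReal]
  refine ⟨clm_ext_of_inner_self fun x => ?_, hsa⟩
  rw [mul_apply_eq_comp, ← ContinuousLinearMap.adjoint_inner_left,
    ← ContinuousLinearMap.star_eq_adjoint, hsa, inner_self_eq_norm_sq_to_K,
    inner_cutProj Ψ hS, ← norm_sq_cutProj Ψ hS]
  simp

/-- What a finite partial sum misses is the projection of the remaining set, and its squared norm on
`x` is a tail of the scalar measure. -/
theorem hasSum_cutProj (A : ℕ → Set X) (hA : ∀ n, MeasurableSet (A n))
    (hd : Pairwise (fun m n => Disjoint (A m) (A n))) (x : 𝓗) :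
    HasSum (fun n => cutProj Ψ (A n) x) (cutProj Ψ (⋃ n, A n) x) := by
  have hU : MeasurableSet (⋃ n, A n) := MeasurableSet.iUnion hA
  have key : ∀ F : Finset ℕ, cutProj Ψ (⋃ n, A n) - ∑ n ∈ F, cutProj Ψ (A n)
      = cutProj Ψ ((⋃ n, A n) \ ⋃ n ∈ F, A n) := by
    intro F
    have hF : MeasurableSet (⋃ n ∈ F, A n) := F.measurableSet_biUnion fun n _ => hA n
    refine clm_ext_of_inner_self fun y => ?_
    rw [sub_apply, sum_apply, inner_sub_right, inner_sum,
      inner_cutProj Ψ (hU.diff hF), inner_cutProj Ψ hU,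
      measureReal_sdiff (iUnion₂_subset fun n _ => subset_iUnion A n) hF,
      measureReal_biUnion_finset (fun i _ j _ hij => hd hij) fun n _ => hA n]
    simp only [inner_cutProj Ψ (hA _)]
    push_cast
    rfl
  have hs : HasSum (fun n => (vectorMeasure Ψ x).real (A n))
      ((vectorMeasure Ψ x).real (⋃ n, A n)) := by
    have h := measure_iUnion (μ := vectorMeasure Ψ x) hd hA
    rw [Measure.real, h, ENNReal.tsum_toReal_eq fun n => measure_ne_top _ _]
    exact ENNReal.hasSum_toReal (h ▸ measure_ne_top _ _)
  rw [HasSum, tendsto_iff_norm_sub_tendsto_zero]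
  have h2 : Tendsto (fun F : Finset ℕ => ‖∑ n ∈ F, cutProj Ψ (A n) x - cutProj Ψ (⋃ n, A n) x‖ ^ 2)
      atTop (𝓝 0) := by
    have h3 : Tendsto (fun F : Finset ℕ => (vectorMeasure Ψ x).real (⋃ n, A n)
        - ∑ n ∈ F, (vectorMeasure Ψ x).real (A n)) atTop (𝓝 0) := by
      simpa using hs.const_sub ((vectorMeasure Ψ x).real (⋃ n, A n))
    refine h3.congr fun F => ?_
    have hF : MeasurableSet (⋃ n ∈ F, A n) := F.measurableSet_biUnion fun n _ => hA n
    have e : cutProj Ψ (⋃ n, A n) x - ∑ n ∈ F, cutProj Ψ (A n) x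
        = cutProj Ψ ((⋃ n, A n) \ ⋃ n ∈ F, A n) x := by
      rw [← key F, sub_apply, sum_apply]
    rw [norm_sub_rev, e, norm_sq_cutProj Ψ (hU.diff hF),
      measureReal_sdiff (iUnion₂_subset fun n _ => subset_iUnion A n) hF,
      measureReal_biUnion_finset (fun i _ j _ hij => hd hij) fun n _ => hA n]
  have := h2.sqrt
  simpa [Real.sqrt_sq (norm_nonneg _)] using this

/-- The image of the spectral measure of `Ψ` under a Borel function `κ`. -/
def pvmOfRepresentation {κ : X → ℝ} (hκ : Measurable κ) : ProjectionValuedMeasure 𝓗 where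
  proj S := cutProj Ψ (κ ⁻¹' S)
  isStarProjection S hS := isStarProjection_cutProj Ψ (hκ hS)
  proj_univ := clm_ext_of_inner_self fun x => by
    rw [preimage_univ, inner_cutProj Ψ MeasurableSet.univ, vectorMeasure_real_univ,
      one_apply_eq_self, inner_self_eq_norm_sq_to_K]
    simp
  hasSum_iUnion A hA hd x := by
    rw [preimage_iUnion]
    exact hasSum_cutProj Ψ _ (fun n => hκ (hA n)) (fun i j hij => (hd hij).preimage κ) x

theorem scalarMeasure_pvmOfRepresentation {κ : X → ℝ} (hκ : Measurable κ) (x : 𝓗) :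
    (pvmOfRepresentation Ψ hκ).scalarMeasure x = (vectorMeasure Ψ x).map κ := by
  ext S hS
  rw [ProjectionValuedMeasure.scalarMeasure_apply _ _ hS, Measure.map_apply hκ hS]
  change ENNReal.ofReal (inner ℂ x (cutProj Ψ (κ ⁻¹' S) x)).re = _
  rw [inner_cutProj Ψ (hκ hS), Complex.ofReal_re, ofReal_measureReal]

end Representation

/-! ### The spectral theorem -/

section Resolvent

variable {A : 𝓗 →ₗ.[ℂ] 𝓗}

theorem inner_symm_of_isSelfAdjoint (hA : IsSelfAdjoint A) (u v : A.domain) :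
    inner ℂ (A u) (v : 𝓗) = inner ℂ (u : 𝓗) (A v) := by
  have h := LinearPMap.adjoint_isFormalAdjoint hA.dense_domain (T := A)
  rw [LinearPMap.isSelfAdjoint_def.mp hA] at h
  exact h u v

/-- Since `⟨A u, u⟩` is real the cross term vanishes: `‖(A + σ i) u‖² = ‖A u‖² + ‖u‖²`. -/
theorem norm_le_norm_add_smul_I (hA : IsSelfAdjoint A) {σ : ℝ} (hσ : σ ^ 2 = 1) (u : A.domain) :
    ‖(u : 𝓗)‖ ≤ ‖A u + (σ * Complex.I : ℂ) • (u : 𝓗)‖ := by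
  refine le_of_sq_le_sq ?_ (norm_nonneg _)
  have hs := inner_symm_of_isSelfAdjoint hA u u
  have him : (inner ℂ (A u) (u : 𝓗)).im = 0 := by
    have := congrArg Complex.im (inner_conj_symm (A u) (u : 𝓗))
    rw [Complex.conj_im, ← hs] at this
    linarith
  rw [norm_add_sq (𝕜 := ℂ), inner_smul_right, norm_smul]
  have e1 : ‖(σ * Complex.I : ℂ)‖ = |σ| := by simp
  have e2 : RCLike.re ((σ * Complex.I : ℂ) * inner ℂ (A u) (u : 𝓗)) = 0 := by
    change ((σ * Complex.I : ℂ) * inner ℂ (A u) (u : 𝓗)).re = 0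
    simp [him]
  rw [e1, e2, mul_pow, sq_abs, hσ]
  nlinarith [sq_nonneg ‖A u‖]

/-- The range is closed, by the lower bound and the closed graph of `A`. A vector orthogonal to it
lies in the domain of the adjoint, hence of `A`, and is an eigenvector for `σ i` unless it is zero.
-/
theorem exists_add_smul_I_eq (hA : IsSelfAdjoint A) {σ : ℝ} (hσ : σ ^ 2 = 1) (y : 𝓗) :
    ∃ u : A.domain, A u + (σ * Complex.I : ℂ) • (u : 𝓗) = y := by
  let T : A.domain →ₗ[ℂ] 𝓗 := A.toFun + (σ * Complex.I : ℂ) • A.domain.subtype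
  have hT : ∀ u, T u = A u + (σ * Complex.I : ℂ) • (u : 𝓗) := fun u => rfl
  have hclosed : IsClosed (LinearMap.range T : Set 𝓗) := by
    refine isClosed_of_closure_subset fun z hz => ?_
    obtain ⟨y, hy, hyz⟩ := mem_closure_iff_seq_limit.mp hz
    choose u hu using hy
    have hc : CauchySeq fun n => (u n : 𝓗) := by
      rw [Metric.cauchySeq_iff]
      intro ε hε
      obtain ⟨N, hN⟩ := Metric.cauchySeq_iff.mp hyz.cauchySeq ε hε
      refine ⟨N, fun m hm n hn => lt_of_le_of_lt ?_ (hN m hm n hn)⟩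
      rw [dist_eq_norm, dist_eq_norm, ← hu, ← hu, ← map_sub, hT]
      exact norm_le_norm_add_smul_I hA hσ (u m - u n)
    obtain ⟨v, hv⟩ := cauchySeq_tendsto_of_complete hc
    have hAu : Tendsto (fun n => A (u n)) atTop (𝓝 (z - (σ * Complex.I : ℂ) • v)) := by
      refine (hyz.sub (hv.const_smul (σ * Complex.I : ℂ))).congr fun n => ?_
      rw [← hu, hT, add_sub_cancel_right]
    have hmem : ((v, z - (σ * Complex.I : ℂ) • v) : 𝓗 × 𝓗) ∈ (A.graph : Set (𝓗 × 𝓗)) :=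
      hA.isClosed.mem_of_tendsto (hv.prodMk_nhds hAu) (Eventually.of_forall fun n => A.mem_graph (u n))
    obtain ⟨w, hw1, hw2⟩ := (LinearPMap.mem_graph_iff A).mp hmem
    refine ⟨w, ?_⟩
    rw [hT, hw2]
    simp [hw1]
  have hperp : (LinearMap.range T)ᗮ = ⊥ := by
    rw [Submodule.eq_bot_iff]
    intro z hz
    have h1 : ∀ u : A.domain, inner ℂ ((σ * Complex.I : ℂ) • z) (u : 𝓗) = inner ℂ z (A u) := by
      intro u
      have := (Submodule.mem_orthogonal' _ _).mp hz (T u) ⟨u, rfl⟩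
      rw [hT, inner_add_right, inner_smul_right] at this
      rw [inner_smul_left]
      simp only [map_mul, Complex.conj_ofReal, Complex.conj_I]
      linear_combination -this
    have h2 : z ∈ A.adjoint.domain := LinearPMap.mem_adjoint_domain_of_exists z ⟨_, h1⟩
    have h3 := LinearPMap.adjoint_apply_eq hA.dense_domain ⟨z, h2⟩ h1
    have h4 : ∃ v : A.domain, (v : 𝓗) = z ∧ A v = (σ * Complex.I : ℂ) • z := by
      have hg : ((z, (σ * Complex.I : ℂ) • z) : 𝓗 × 𝓗) ∈ A.adjoint.graph := by
        rw [← h3]; exact A.adjoint.mem_graph ⟨z, h2⟩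
      rw [LinearPMap.isSelfAdjoint_def.mp hA] at hg
      obtain ⟨w, hw1, hw2⟩ := (LinearPMap.mem_graph_iff A).mp hg
      exact ⟨w, hw1, hw2⟩
    obtain ⟨v, rfl, hv⟩ := h4
    -- The eigenvalue equation says `(A - σ i) v = 0`, so the lower bound is needed with the
    -- opposite sign.
    have := norm_le_norm_add_smul_I hA (σ := -σ) (by simpa using hσ) v
    rw [hv] at this
    simpa using this
  have htop : LinearMap.range T = ⊤ := by
    have : (LinearMap.range T).HasOrthogonalProjection := by
      have : CompleteSpace (LinearMap.range T) := hclosed.completeSpace_coe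
      infer_instance
    exact Submodule.orthogonal_eq_bot_iff.mp hperp
  obtain ⟨u, hu⟩ := (htop ▸ Submodule.mem_top : y ∈ LinearMap.range T)
  exact ⟨u, hu⟩

/-- The inverse of `A + σ i`, `σ = ± 1`, is a bounded operator. -/
theorem exists_resolvent (hA : IsSelfAdjoint A) {σ : ℝ} (hσ : σ ^ 2 = 1) :
    ∃ R : 𝓗 →L[ℂ] 𝓗, (∀ u : A.domain, R (A u + (σ * Complex.I : ℂ) • (u : 𝓗)) = u) ∧
      ∀ y, ∃ u : A.domain, (u : 𝓗) = R y ∧ A u + (σ * Complex.I : ℂ) • (u : 𝓗) = y := by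
  let T : A.domain →ₗ[ℂ] 𝓗 := A.toFun + (σ * Complex.I : ℂ) • A.domain.subtype
  have hb : ∀ u : A.domain, ‖(u : 𝓗)‖ ≤ ‖T u‖ := norm_le_norm_add_smul_I hA hσ
  have hinj : Function.Injective T := by
    rw [injective_iff_map_eq_zero]
    intro u hu
    have := hb u
    rw [hu, norm_zero] at this
    exact Subtype.ext (norm_le_zero_iff.mp this)
  let e := LinearEquiv.ofBijective T ⟨hinj, exists_add_smul_I_eq hA hσ⟩
  refine ⟨LinearMap.mkContinuous (A.domain.subtype ∘ₗ e.symm.toLinearMap) 1 fun y => ?_,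
    fun u => ?_, fun y => ⟨e.symm y, rfl, e.apply_symm_apply y⟩⟩
  · rw [one_mul]
    refine (hb (e.symm y)).trans_eq ?_
    exact congrArg norm (e.apply_symm_apply y)
  · exact congrArg Subtype.val (e.symm_apply_apply u)

/-- The adjoint of `(A + i)⁻¹` is `(A - i)⁻¹`, and the resolvent identity in both orders gives
normality. The identity is kept because it places the spectrum on a circle: the image of the line
under `l ↦ 1 / (l + i)`, together with 0. -/
theorem exists_normal_resolvent (hA : IsSelfAdjoint A) :
    ∃ R : 𝓗 →L[ℂ] 𝓗, (∀ u : A.domain, R (A u + Complex.I • (u : 𝓗)) = u) ∧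
      (∀ y, R y ∈ A.domain) ∧ IsStarNormal R ∧ R - star R = (-2 * Complex.I) • (R * star R) := by
  obtain ⟨R, hR1, hR2⟩ := exists_resolvent hA (σ := 1) (by norm_num)
  obtain ⟨R', hR1', hR2'⟩ := exists_resolvent hA (σ := -1) (by norm_num)
  have hadj : star R = R' := by
    rw [ContinuousLinearMap.star_eq_adjoint, eq_comm, ContinuousLinearMap.eq_adjoint_iff]
    intro x y
    obtain ⟨u, hu, hux⟩ := hR2' x
    obtain ⟨v, hv, hvy⟩ := hR2 y
    rw [← hu, ← hv, ← hux, ← hvy, inner_add_left, inner_add_right, inner_smul_left,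
      inner_smul_right, inner_symm_of_isSelfAdjoint hA]
    simp
  have h1 : R - R' = (-2 * Complex.I) • (R * R') := by
    ext y
    obtain ⟨u, hu, huy⟩ := hR2' y
    have e : y = (A u + ((1 : ℝ) * Complex.I : ℂ) • (u : 𝓗)) - (2 * Complex.I) • (u : 𝓗) := by
      rw [← huy, add_sub_assoc, ← sub_smul]
      congr 2
      push_cast
      ring
    have : R y = u - (2 * Complex.I) • R (u : 𝓗) := by
      conv_lhs => rw [e, map_sub, hR1, map_smul]
    rw [sub_apply, smul_apply, mul_apply_eq_comp, this, ← hu]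
    module
  have h2 : R - R' = (-2 * Complex.I) • (R' * R) := by
    ext y
    obtain ⟨u, hu, huy⟩ := hR2 y
    have e : y = (A u + ((-1 : ℝ) * Complex.I : ℂ) • (u : 𝓗)) + (2 * Complex.I) • (u : 𝓗) := by
      rw [← huy, add_assoc, ← add_smul]
      congr 2
      push_cast
      ring
    have : R' y = u + (2 * Complex.I) • R' (u : 𝓗) := by
      conv_lhs => rw [e, map_add, hR1', map_smul]
    rw [sub_apply, smul_apply, mul_apply_eq_comp, this, ← hu]
    module
  refine ⟨R, fun u => by simpa using hR1 u, fun y => ?_, ⟨?_⟩, ?_⟩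
  · obtain ⟨u, hu, -⟩ := hR2 y
    rw [← hu]; exact u.2
  · rw [hadj]
    have h3 := h2.symm.trans h1
    exact (smul_right_injective _ (by simp : (-2 * Complex.I : ℂ) ≠ 0)) h3
  · rw [hadj, h1]

end Resolvent

/-- The continuous functional calculus of the normal operator `R = (A + i)⁻¹` yields projections on
its spectrum, which are moved to the line by inverting `l ↦ 1 / (l + i)`. The point 0 corresponds to
infinity and must be shown to carry no mass. -/
theorem exists_isSpectralMeasure {A : 𝓗 →ₗ.[ℂ] 𝓗} (hA : IsSelfAdjoint A) :
    ∃ E, IsSpectralMeasure E A := by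
  obtain ⟨R, hR1, hR2, hN, hid⟩ := exists_normal_resolvent hA
  let X := spectrum ℂ R
  let Ψ : C(X, ℂ) →⋆ₐ[ℂ] (𝓗 →L[ℂ] 𝓗) := cfcHom hN
  let ι : C(X, ℂ) := ContinuousMap.restrict X (ContinuousMap.id ℂ)
  have hι : Ψ ι = R := cfcHom_id hN
  have hspec : ∀ w : X, (w : ℂ) - starRingEnd ℂ w = (-2 * Complex.I) * (w * starRingEnd ℂ w) := by
    have hΨ : Function.Injective Ψ := cfcHom_injective hN
    have : Ψ (ι - star ι) = Ψ ((-2 * Complex.I) • (ι * star ι)) := by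
      rw [map_sub, map_smul, map_mul, map_star, hι, hid]
    intro w
    exact congrArg (fun f : C(X, ℂ) => f w) (hΨ this)
  -- At `w = 0` the value is 0 by the convention for inverses; `hzero` makes this harmless.
  let κ : X → ℝ := fun w => ((w : ℂ)⁻¹).re
  have hκ : Measurable κ := by
    exact Complex.measurable_re.comp (measurable_subtype_coe.inv)
  have hres : ∀ w : X, (w : ℂ) ≠ 0 → res 1 (κ w) = w := by
    intro w hw
    have him : ((w : ℂ)⁻¹).im = 1 := by
      have h := hspec w
      have hc : starRingEnd ℂ (w : ℂ) ≠ 0 := by simpa using hw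
      have h2 : (starRingEnd ℂ (w : ℂ))⁻¹ - (w : ℂ)⁻¹ = -2 * Complex.I := by
        field_simp
        linear_combination h
      rw [← map_inv₀] at h2
      have := congrArg Complex.im h2
      simp only [Complex.sub_im, Complex.conj_im, Complex.mul_im, Complex.I_im] at this
      norm_num at this
      simp only [Complex.inv_im]
      linarith
    have : ((κ w : ℝ) : ℂ) + ((1 : ℝ) : ℂ) * Complex.I = (w : ℂ)⁻¹ := by
      apply Complex.ext <;> simp [κ, -Complex.inv_re, -Complex.inv_im, him]
    rw [res, this, inv_inv]
  -- The projection onto the kernel of `R` annihilates the range of `R`, which contains `dom A` and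
  -- is dense.
  have hzero : cutProj Ψ {w : X | (w : ℂ) = 0} = 0 := by
    have hS : MeasurableSet {w : X | (w : ℂ) = 0} :=
      measurable_subtype_coe (measurableSet_singleton (0 : ℂ))
    have hR : ∀ x, cutProj Ψ {w : X | (w : ℂ) = 0} (R x) = 0 := by
      intro x
      rw [← norm_eq_zero, ← sq_eq_zero_iff, norm_sq_cutProj Ψ hS]
      refine le_antisymm ?_ measureReal_nonneg
      have hlim : Tendsto (fun n : ℕ => 1 / ((n : ℝ) + 1) * ‖x‖ ^ 2) atTop (𝓝 0) := by
        simpa using tendsto_one_div_add_atTop_nhds_zero_nat.mul_const (‖x‖ ^ 2)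
      refine ge_of_tendsto' hlim fun n => ?_
      -- A bump equal to 1 at `w = 0` with `h w * |w|² ≤ 1 / (n + 1)`; the factor `|w|²` appears
      -- when the state of `R x` is rewritten as the state of `x`.
      let h : C(X, ℝ) := ⟨fun w => max 0 (1 - (n + 1) * ‖(w : ℂ)‖ ^ 2), by fun_prop⟩
      have h1 : (vectorMeasure Ψ (R x)).real {w : X | (w : ℂ) = 0}
          ≤ ∫ w, h w ∂vectorMeasure Ψ (R x) := by
        have e : (vectorMeasure Ψ (R x)).real {w : X | (w : ℂ) = 0} = ∫ w,
            {w : X | (w : ℂ) = 0}.indicator (fun _ => (1 : ℝ)) w ∂vectorMeasure Ψ (R x) := by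
          rw [integral_indicator_const _ hS]; simp
        rw [e]
        refine integral_mono ((integrable_const 1).indicator hS) (continuousMap_integrable h _)
          fun w => ?_
        by_cases hw : (w : ℂ) = 0
        · simp [h, hw]
        · simp [h, hw]
      refine h1.trans ?_
      have e2 : ((∫ w, h w ∂vectorMeasure Ψ (R x) : ℝ) : ℂ)
          = ((∫ w, h w * ‖(w : ℂ)‖ ^ 2 ∂vectorMeasure Ψ x : ℝ) : ℂ) := by
        have hιx : Ψ ι x = R x := by rw [hι]
        rw [← inner_liftReal Ψ h (R x), ← hιx, ← mul_apply_eq_comp, ← map_mul, inner_map_star]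
        let k : C(X, ℝ) := ⟨fun w => h w * ‖(w : ℂ)‖ ^ 2, by fun_prop⟩
        have : star ι * (liftReal h * ι) = liftReal k := by
          ext w
          have : starRingEnd ℂ (w : ℂ) * w = ((‖(w : ℂ)‖ ^ 2 : ℝ) : ℂ) := by
            rw [mul_comm, Complex.mul_conj, Complex.normSq_eq_norm_sq]
          change starRingEnd ℂ (w : ℂ) * ((h w : ℂ) * w) = ((h w * ‖(w : ℂ)‖ ^ 2 : ℝ) : ℂ)
          rw [Complex.ofReal_mul, ← this]
          ring
        rw [this, inner_liftReal]
        rfl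
      rw [Complex.ofReal_injective e2]
      have hn : (0 : ℝ) < n + 1 := by positivity
      have h3 : ∀ w : X, ‖h w * ‖(w : ℂ)‖ ^ 2‖ ≤ 1 / ((n : ℝ) + 1) := by
        intro w
        have h0 : 0 ≤ h w := le_max_left _ _
        rw [Real.norm_of_nonneg (by positivity), le_div_iff₀ hn]
        change max 0 (1 - (n + 1) * ‖(w : ℂ)‖ ^ 2) * ‖(w : ℂ)‖ ^ 2 * (n + 1) ≤ 1
        set t := ((n : ℝ) + 1) * ‖(w : ℂ)‖ ^ 2
        have e : max 0 (1 - t) * ‖(w : ℂ)‖ ^ 2 * (n + 1) = max 0 (1 - t) * t := by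
          simp only [t]; ring
        rw [e]
        rcases le_total (1 - t) 0 with h | h
        · rw [max_eq_left h]; simp
        · rw [max_eq_right h]; nlinarith
      refine (le_abs_self _).trans ?_
      rw [← vectorMeasure_real_univ Ψ x]
      exact norm_integral_le_of_norm_le_const (ae_of_all _ h3)
    have hdense : DenseRange R := by
      refine hA.dense_domain.mono fun u hu => ⟨_, hR1 ⟨u, hu⟩⟩
    refine ContinuousLinearMap.ext fun x => ?_
    exact congrFun (hdense.equalizer (cutProj Ψ _).continuous continuous_zero (funext hR)) x
  let E := pvmOfRepresentation Ψ hκ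
  have hE : E.integral (res 1) = R := by
    refine ProjectionValuedMeasure.HasIntegral.integral_eq (bddMeas_res one_ne_zero) fun x => ?_
    have hS : MeasurableSet {w : X | (w : ℂ) = 0} :=
      measurable_subtype_coe (measurableSet_singleton (0 : ℂ))
    rw [scalarMeasure_pvmOfRepresentation, integral_map hκ.aemeasurable
      (continuous_res one_ne_zero).aestronglyMeasurable]
    conv_lhs => rw [← hι, inner_eq_integral]
    refine integral_congr_ae ?_
    have h0 : (vectorMeasure Ψ x).real {w : X | (w : ℂ) = 0} = 0 := by
      have := norm_sq_cutProj Ψ hS x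
      rw [hzero] at this
      simpa using this.symm
    have h0' : ∀ᵐ w : X ∂vectorMeasure Ψ x, ¬ ((w : ℂ) = 0) := by
      rw [ae_iff]
      simpa [measureReal_eq_zero_iff] using h0
    filter_upwards [h0'] with w hw
    exact (hres w hw).symm
  exact ⟨E, isSpectralMeasure_of_integral_res (by rw [hE]; exact hR1) (by rw [hE]; exact hR2)⟩

theorem exists_isFunctionOf {A : 𝓗 →ₗ.[ℂ] 𝓗} (hA : IsSelfAdjoint A) {φ : ℝ → ℝ}
    (hφ : Measurable φ) (hb : ∃ C : ℝ, ∀ x, |φ x| ≤ C) : ∃ B, IsFunctionOf A φ B := by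
  obtain ⟨E, hE⟩ := exists_isSpectralMeasure hA
  refine ⟨E.integral fun l => (φ l : ℂ), E, hE, fun x => ?_⟩
  rw [E.hasIntegral_integral (BddMeas.ofReal hφ hb) x, integral_complex_ofReal]

/-! ### Hilbert-Schmidt operators -/

/-- The Hilbert-Schmidt operators. -/
def IsHS (L : 𝓗 →L[ℂ] 𝓗) : Prop := Summable fun i => ‖L (basis 𝓗 i)‖ ^ 2

/-- The square of the Hilbert-Schmidt norm. -/
def hsNormSq (L : 𝓗 →L[ℂ] 𝓗) : ℝ := ∑' i, ‖L (basis 𝓗 i)‖ ^ 2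

theorem hasSum_norm_sq_inner_basis (x : 𝓗) :
    HasSum (fun i => ‖inner ℂ (basis 𝓗 i) x‖ ^ 2) (‖x‖ ^ 2) := by
  have h := (basis 𝓗).hasSum_inner_mul_inner x x
  have h2 := h.mapL Complex.reCLM
  simp only [Complex.reCLM_apply] at h2
  have e : (inner ℂ x x).re = ‖x‖ ^ 2 := inner_self_eq_norm_sq (𝕜 := ℂ) x
  rw [e] at h2
  refine h2.congr_fun fun i => ?_
  rw [← inner_conj_symm x, ← Complex.normSq_eq_conj_mul_self, Complex.ofReal_re,
    Complex.normSq_eq_norm_sq]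

/-- In terms of matrix entries the condition is symmetric under taking adjoints. -/
theorem isHS_iff_summable_prod (L : 𝓗 →L[ℂ] 𝓗) :
    IsHS L ↔ Summable fun p : basisIndex 𝓗 × basisIndex 𝓗 =>
      ‖inner ℂ (basis 𝓗 p.2) (L (basis 𝓗 p.1))‖ ^ 2 := by
  rw [summable_prod_of_nonneg (fun _ => by positivity)]
  simp only [(hasSum_norm_sq_inner_basis _).tsum_eq]
  exact ⟨fun h => ⟨fun i => (hasSum_norm_sq_inner_basis _).summable, h⟩, fun h => h.2⟩

theorem norm_inner_star (L : 𝓗 →L[ℂ] 𝓗) (x y : 𝓗) :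
    ‖inner ℂ x (star L y)‖ = ‖inner ℂ y (L x)‖ := by
  rw [ContinuousLinearMap.star_eq_adjoint, ContinuousLinearMap.adjoint_inner_right,
    norm_inner_symm]

theorem IsHS.star {L : 𝓗 →L[ℂ] 𝓗} (h : IsHS L) : IsHS (star L) := by
  rw [isHS_iff_summable_prod] at h ⊢
  simp only [norm_inner_star]
  exact (Equiv.prodComm _ _).summable_iff.mpr h

theorem hsNormSq_star {L : 𝓗 →L[ℂ] 𝓗} (h : IsHS L) : hsNormSq (star L) = hsNormSq L := by
  have h1 := (isHS_iff_summable_prod L).mp h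
  have h2 : Summable (Function.uncurry fun i k : basisIndex 𝓗 =>
    ‖inner ℂ (basis 𝓗 k) (L (basis 𝓗 i))‖ ^ 2) := h1
  have := h2.tsum_comm
  simp only [(hasSum_norm_sq_inner_basis _).tsum_eq] at this
  rw [hsNormSq, hsNormSq, ← this]
  congr 1
  ext k
  rw [← (hasSum_norm_sq_inner_basis _).tsum_eq]
  simp only [norm_inner_star]

theorem norm_sq_mul_le (X L : 𝓗 →L[ℂ] 𝓗) (x : 𝓗) :
    ‖(X * L) x‖ ^ 2 ≤ ‖X‖ ^ 2 * ‖L x‖ ^ 2 := by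
  rw [mul_apply_eq_comp, ← mul_pow]
  exact pow_le_pow_left₀ (norm_nonneg _) (X.le_opNorm _) 2

theorem IsHS.mul_left {L : 𝓗 →L[ℂ] 𝓗} (h : IsHS L) (X : 𝓗 →L[ℂ] 𝓗) : IsHS (X * L) :=
  Summable.of_nonneg_of_le (fun _ => by positivity) (fun _ => norm_sq_mul_le X L _)
    (Summable.mul_left (‖X‖ ^ 2) h)

theorem hsNormSq_mul_left_le {L : 𝓗 →L[ℂ] 𝓗} (h : IsHS L) (X : 𝓗 →L[ℂ] 𝓗) :
    hsNormSq (X * L) ≤ ‖X‖ ^ 2 * hsNormSq L := by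
  rw [hsNormSq, hsNormSq, ← tsum_mul_left]
  exact (h.mul_left X).tsum_le_tsum (fun i => norm_sq_mul_le X L _) (Summable.mul_left _ h)

theorem IsHS.mul_right {L : 𝓗 →L[ℂ] 𝓗} (h : IsHS L) (X : 𝓗 →L[ℂ] 𝓗) : IsHS (L * X) := by
  have := (h.star.mul_left (Star.star X)).star
  rwa [star_mul, star_star, star_star] at this

theorem hsNormSq_mul_right_le {L : 𝓗 →L[ℂ] 𝓗} (h : IsHS L) (X : 𝓗 →L[ℂ] 𝓗) :
    hsNormSq (L * X) ≤ ‖X‖ ^ 2 * hsNormSq L := by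
  have := hsNormSq_mul_left_le h.star (star X)
  rwa [← star_mul, hsNormSq_star (h.mul_right X), hsNormSq_star h, norm_star] at this

theorem norm_inner_le_half (x y : 𝓗) : ‖inner ℂ x y‖ ≤ (‖x‖ ^ 2 + ‖y‖ ^ 2) / 2 := by
  have := norm_inner_le_norm (𝕜 := ℂ) x y
  nlinarith [sq_nonneg (‖x‖ - ‖y‖)]

theorem IsHS.summable_inner {L M : 𝓗 →L[ℂ] 𝓗} (hL : IsHS L) (hM : IsHS M) :
    Summable fun i => inner ℂ (L (basis 𝓗 i)) (M (basis 𝓗 i)) :=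
  Summable.of_norm_bounded ((hL.add hM).div_const 2) fun _ => norm_inner_le_half _ _

/-- This is `tr(L* M) = tr(M L*)`: both sides are the same absolutely convergent double series of
matrix entries, summed in different orders. -/
theorem IsHS.tsum_inner_comm {L M : 𝓗 →L[ℂ] 𝓗} (hL : IsHS L) (hM : IsHS M) :
    ∑' i, inner ℂ (L (basis 𝓗 i)) (M (basis 𝓗 i))
      = ∑' i, inner ℂ (Star.star M (basis 𝓗 i)) (Star.star L (basis 𝓗 i)) := by
  have h1 := (isHS_iff_summable_prod L).mp hL
  have h2 := (isHS_iff_summable_prod M).mp hM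
  have hs : Summable (Function.uncurry fun i k : basisIndex 𝓗 =>
      inner ℂ (L (basis 𝓗 i)) (basis 𝓗 k) * inner ℂ (basis 𝓗 k) (M (basis 𝓗 i))) := by
    refine Summable.of_norm_bounded ((h1.add h2).div_const 2) fun p => ?_
    simp only [Function.uncurry]
    rw [norm_mul, norm_inner_symm]
    nlinarith [sq_nonneg (‖inner ℂ (basis 𝓗 p.2) (L (basis 𝓗 p.1))‖
      - ‖inner ℂ (basis 𝓗 p.2) (M (basis 𝓗 p.1))‖)]
  have := hs.tsum_comm
  simp only [(basis 𝓗).tsum_inner_mul_inner] at this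
  rw [← this]
  congr 1
  ext k
  rw [← (basis 𝓗).tsum_inner_mul_inner]
  congr 1
  ext i
  rw [ContinuousLinearMap.star_eq_adjoint, ContinuousLinearMap.star_eq_adjoint,
    ContinuousLinearMap.adjoint_inner_left, ContinuousLinearMap.adjoint_inner_right, mul_comm]

theorem IsHS.norm_sq_le {L : 𝓗 →L[ℂ] 𝓗} (h : IsHS L) : ‖L‖ ^ 2 ≤ hsNormSq L := by
  have h0 : 0 ≤ hsNormSq L := tsum_nonneg fun _ => by positivity
  suffices ‖L‖ ≤ √(hsNormSq L) by
    have := pow_le_pow_left₀ (norm_nonneg _) this 2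
    rwa [Real.sq_sqrt h0] at this
  refine L.opNorm_le_bound (Real.sqrt_nonneg _) fun x => ?_
  refine le_of_sq_le_sq ?_ (by positivity)
  rw [mul_pow, Real.sq_sqrt h0, ← hsNormSq_star h, hsNormSq, ← tsum_mul_right,
    ← (hasSum_norm_sq_inner_basis (L x)).tsum_eq]
  refine (hasSum_norm_sq_inner_basis (L x)).summable.tsum_le_tsum (fun i => ?_)
    (Summable.mul_right _ h.star)
  rw [← mul_pow]
  refine pow_le_pow_left₀ (norm_nonneg _) ?_ 2
  rw [← ContinuousLinearMap.adjoint_inner_left, ← ContinuousLinearMap.star_eq_adjoint]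
  exact norm_inner_le_norm _ _

/-! ### Positive operators and square roots -/

theorem inner_mul_self_of_isSelfAdjoint {L : 𝓗 →L[ℂ] 𝓗} (hL : IsSelfAdjoint L) (x y : 𝓗) :
    inner ℂ x ((L * L) y) = inner ℂ (L x) (L y) := by
  rw [mul_apply_eq_comp, ← ContinuousLinearMap.adjoint_inner_left,
    ContinuousLinearMap.isSelfAdjoint_iff'.mp hL]

theorem re_inner_self_nonneg_of_nonneg {K : 𝓗 →L[ℂ] 𝓗} (hK : 0 ≤ K) (x : 𝓗) :
    0 ≤ (inner ℂ x (K x)).re :=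
  ((ContinuousLinearMap.nonneg_iff_isPositive K).mp hK).re_inner_nonneg_right x

theorem re_inner_mono {K K' : 𝓗 →L[ℂ] 𝓗} (h : K ≤ K') (x : 𝓗) :
    (inner ℂ x (K x)).re ≤ (inner ℂ x (K' x)).re := by
  have := re_inner_self_nonneg_of_nonneg (sub_nonneg.mpr h) x
  rw [sub_apply, inner_sub_right, Complex.sub_re] at this
  linarith

theorem exists_hs_sqrt {K : 𝓗 →L[ℂ] 𝓗} (hK : 0 ≤ K)
    (hs : Summable fun i => (inner ℂ (basis 𝓗 i) (K (basis 𝓗 i))).re) :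
    ∃ L : 𝓗 →L[ℂ] 𝓗, IsSelfAdjoint L ∧ IsHS L ∧ L * L = K := by
  have hL : IsSelfAdjoint (CFC.sqrt K) := (CFC.sqrt_nonneg K).isSelfAdjoint
  have hLL : CFC.sqrt K * CFC.sqrt K = K := CFC.sqrt_mul_sqrt_self K hK
  refine ⟨CFC.sqrt K, hL, hs.congr fun i => ?_, hLL⟩
  have := inner_mul_self_of_isSelfAdjoint hL (basis 𝓗 i) (basis 𝓗 i)
  rw [hLL] at this
  rw [this]
  exact inner_self_eq_norm_sq (𝕜 := ℂ) (CFC.sqrt K (basis 𝓗 i))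

theorem IsTraceClass.summable_abs {K : 𝓗 →L[ℂ] 𝓗} (hK : IsTraceClass K) :
    Summable fun i => (inner ℂ (basis 𝓗 i) (CFC.abs K (basis 𝓗 i))).re := by
  have h := ENNReal.summable_toReal hK.ne
  refine h.congr fun i => ?_
  rw [ENNReal.toReal_ofReal (re_inner_self_nonneg_of_nonneg (CFC.abs_nonneg K) _)]

/-- The positive and negative parts are dominated by `|K|`, so their square roots are
Hilbert-Schmidt. Statements about traces thereby reduce to operators `L * L`. -/
theorem IsTraceClass.exists_hs_decomposition {K : 𝓗 →L[ℂ] 𝓗} (hK : IsTraceClass K)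
    (hsa : IsSelfAdjoint K) :
    ∃ L₁ L₂ : 𝓗 →L[ℂ] 𝓗, (IsSelfAdjoint L₁ ∧ IsHS L₁) ∧ (IsSelfAdjoint L₂ ∧ IsHS L₂) ∧
      K = L₁ * L₁ - L₂ * L₂ := by
  have hp : 0 ≤ K⁺ := CFC.posPart_nonneg K
  have hn : 0 ≤ K⁻ := CFC.negPart_nonneg K
  have hadd : K⁺ + K⁻ = CFC.abs K := CFC.posPart_add_negPart K hsa
  have h1 : K⁺ ≤ CFC.abs K := hadd ▸ le_add_of_nonneg_right hn
  have h2 : K⁻ ≤ CFC.abs K := hadd ▸ le_add_of_nonneg_left hp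
  obtain ⟨L₁, a1, a2, a3⟩ := exists_hs_sqrt hp (hK.summable_abs.of_nonneg_of_le
    (fun i => re_inner_self_nonneg_of_nonneg hp _) fun i => re_inner_mono h1 _)
  obtain ⟨L₂, b1, b2, b3⟩ := exists_hs_sqrt hn (hK.summable_abs.of_nonneg_of_le
    (fun i => re_inner_self_nonneg_of_nonneg hn _) fun i => re_inner_mono h2 _)
  exact ⟨L₁, L₂, ⟨a1, a2⟩, ⟨b1, b2⟩, by rw [a3, b3, CFC.posPart_sub_negPart K hsa]⟩

/-- If `|K| = L²` then `‖K‖ ≤ ‖L‖²`, which is at most the squared Hilbert-Schmidt norm of `L`, that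
is, the trace norm. Differentiability in trace norm thus implies it in operator norm. -/
theorem ofReal_norm_le_traceNorm (K : 𝓗 →L[ℂ] 𝓗) : ENNReal.ofReal ‖K‖ ≤ traceNorm K := by
  by_cases h : traceNorm K = ∞
  · rw [h]; exact le_top
  have hK : IsTraceClass K := lt_top_iff_ne_top.mpr h
  have hs := hK.summable_abs
  obtain ⟨L, hL, hHS, hLL⟩ := exists_hs_sqrt (CFC.abs_nonneg K) hs
  have e : traceNorm K = ENNReal.ofReal (hsNormSq L) := by
    rw [traceNorm, ← ENNReal.ofReal_tsum_of_nonneg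
      (fun i => re_inner_self_nonneg_of_nonneg (CFC.abs_nonneg K) _) hs, hsNormSq]
    congr 2
    ext i
    rw [← hLL, inner_mul_self_of_isSelfAdjoint hL]
    exact inner_self_eq_norm_sq (𝕜 := ℂ) _
  rw [e, ← CFC.norm_abs, ← hLL]
  refine ENNReal.ofReal_le_ofReal ((norm_mul_le _ _).trans ?_)
  rw [← sq]
  exact hHS.norm_sq_le

/-! ### The trace of a product -/

section TraceMul

variable {L : 𝓗 →L[ℂ] 𝓗}

theorem summable_inner_sq_mul (hL : IsSelfAdjoint L) (hs : IsHS L) (X : 𝓗 →L[ℂ] 𝓗) :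
    Summable fun i => inner ℂ (basis 𝓗 i) ((L * L * X) (basis 𝓗 i)) := by
  refine (hs.summable_inner (hs.mul_right X)).congr fun i => ?_
  rw [mul_apply_eq_comp (L * L), inner_mul_self_of_isSelfAdjoint hL, mul_apply_eq_comp]

theorem summable_inner_conj (hs : IsHS L) (X : 𝓗 →L[ℂ] 𝓗) :
    Summable fun i => inner ℂ (L (basis 𝓗 i)) (X (L (basis 𝓗 i))) := by
  refine (hs.summable_inner (hs.mul_left X)).congr fun i => ?_
  rw [mul_apply_eq_comp]

/-- Cyclicity, `tr(L² X) = tr(L X L)`. In the symmetric form, positivity, reality and strong limits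
in `X` can be read off term by term. -/
theorem trace_sq_mul (hL : IsSelfAdjoint L) (hs : IsHS L) (X : 𝓗 →L[ℂ] 𝓗) :
    trace (L * L * X) = ∑' i, inner ℂ (L (basis 𝓗 i)) (X (L (basis 𝓗 i))) := by
  have h := hs.tsum_inner_comm (hs.mul_right X)
  rw [trace]
  convert h using 2
  · ext i
    rw [mul_apply_eq_comp (L * L), inner_mul_self_of_isSelfAdjoint hL, mul_apply_eq_comp]
  · ext i
    rw [star_mul, hL.star_eq, mul_apply_eq_comp, ContinuousLinearMap.star_eq_adjoint,
      ContinuousLinearMap.adjoint_inner_left]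

/-- Operators `K` such that the series of `tr (K X)` converges for every bounded `X`. -/
def TraceSummable (K : 𝓗 →L[ℂ] 𝓗) : Prop :=
  ∀ X : 𝓗 →L[ℂ] 𝓗, Summable fun i => inner ℂ (basis 𝓗 i) ((K * X) (basis 𝓗 i))

theorem TraceSummable.sub {K K' : 𝓗 →L[ℂ] 𝓗} (h : TraceSummable K) (h' : TraceSummable K') :
    TraceSummable (K - K') := fun X => by
  refine ((h X).sub (h' X)).congr fun i => ?_
  rw [sub_mul, sub_apply, inner_sub_right]

theorem TraceSummable.smul {K : 𝓗 →L[ℂ] 𝓗} (h : TraceSummable K) (c : ℂ) :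
    TraceSummable (c • K) := fun X => by
  refine ((h X).mul_left c).congr fun i => ?_
  rw [smul_mul_assoc, smul_apply, inner_smul_right]

theorem TraceSummable.trace_sub_mul {K K' : 𝓗 →L[ℂ] 𝓗} (h : TraceSummable K)
    (h' : TraceSummable K') (X : 𝓗 →L[ℂ] 𝓗) :
    trace ((K - K') * X) = trace (K * X) - trace (K' * X) := by
  rw [trace, trace, trace, ← (h X).tsum_sub (h' X)]
  congr 1
  ext i
  rw [sub_mul, sub_apply, inner_sub_right]

theorem trace_smul_mul (c : ℂ) (K X : 𝓗 →L[ℂ] 𝓗) :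
    trace ((c • K) * X) = c * trace (K * X) := by
  rw [trace, trace, ← tsum_mul_left]
  congr 1
  ext i
  rw [smul_mul_assoc, smul_apply, inner_smul_right]

theorem traceSummable_sq (hL : IsSelfAdjoint L) (hs : IsHS L) : TraceSummable (L * L) :=
  fun X => summable_inner_sq_mul hL hs X

theorem IsTraceClass.traceSummable {K : 𝓗 →L[ℂ] 𝓗} (hK : IsTraceClass K)
    (hsa : IsSelfAdjoint K) : TraceSummable K := by
  obtain ⟨L₁, L₂, h1, h2, rfl⟩ := hK.exists_hs_decomposition hsa
  exact (traceSummable_sq h1.1 h1.2).sub (traceSummable_sq h2.1 h2.2)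

theorem re_trace_mul_nonneg {K X : 𝓗 →L[ℂ] 𝓗} (hK : TraceSummable K) (hK0 : 0 ≤ K)
    (hX : 0 ≤ X) : 0 ≤ (trace (K * X)).re := by
  have hs : Summable fun i => (inner ℂ (basis 𝓗 i) (K (basis 𝓗 i))).re := by
    have := (hK 1).mapL Complex.reCLM
    simpa using this
  obtain ⟨L, hL, hHS, rfl⟩ := exists_hs_sqrt hK0 hs
  rw [trace_sq_mul hL hHS]
  rw [Complex.re_tsum (summable_inner_conj hHS X)]
  exact tsum_nonneg fun i => re_inner_self_nonneg_of_nonneg hX _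

theorem im_trace_mul_eq_zero {K X : 𝓗 →L[ℂ] 𝓗} (hK : IsTraceClass K) (hsa : IsSelfAdjoint K)
    (hX : IsSelfAdjoint X) : (trace (K * X)).im = 0 := by
  have key : ∀ L : 𝓗 →L[ℂ] 𝓗, IsSelfAdjoint L → IsHS L → (trace (L * L * X)).im = 0 := by
    intro L hL hHS
    rw [trace_sq_mul hL hHS, Complex.im_tsum (summable_inner_conj hHS X)]
    have : ∀ i, (inner ℂ (L (basis 𝓗 i)) (X (L (basis 𝓗 i)))).im = 0 := fun i =>
      hX.isSymmetric.im_inner_self_apply _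
    simp [this]
  obtain ⟨L₁, L₂, h1, h2, rfl⟩ := hK.exists_hs_decomposition hsa
  rw [(traceSummable_sq h1.1 h1.2).trace_sub_mul (traceSummable_sq h2.1 h2.2), Complex.sub_im,
    key L₁ h1.1 h1.2, key L₂ h2.1 h2.2, sub_zero]

end TraceMul

/-- An approximate polar decomposition. -/
theorem exists_approx_polar (A : 𝓗 →L[ℂ] 𝓗) {ε : ℝ} (hε : 0 < ε) :
    ∃ W : 𝓗 →L[ℂ] 𝓗, ‖W‖ ≤ 1 ∧ ∀ x,
      (inner ℂ x (CFC.abs A x)).re ≤ (inner ℂ (W x) (A x)).re + ε * ‖x‖ ^ 2 := by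
  set S := CFC.abs A with hS
  have hS0 : 0 ≤ S := CFC.abs_nonneg A
  have hSsa : IsSelfAdjoint S := hS0.isSelfAdjoint
  have hSS : S * S = star A * A := CFC.abs_mul_abs A
  have hsp : ∀ t ∈ spectrum ℝ S, 0 ≤ t := fun t ht => spectrum_nonneg_of_nonneg hS0 ht
  have hc : ContinuousOn (fun t : ℝ => (t + ε)⁻¹) (spectrum ℝ S) :=
    ContinuousOn.inv₀ (by fun_prop) fun t ht => by have := hsp t ht; positivity
  set Y := cfc (fun t : ℝ => (t + ε)⁻¹) S with hY
  have hYsa : star Y = Y := (cfc_predicate (R := ℝ) _ S : IsSelfAdjoint Y)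
  have hid : cfc (fun t : ℝ => t) S = S := cfc_id' ℝ S
  have hYSS : Y * (S * S) = cfc (fun t : ℝ => (t + ε)⁻¹ * (t * t)) S := by
    rw [cfc_mul _ _ S hc (by fun_prop), cfc_mul _ _ S (by fun_prop) (by fun_prop), hid]
  have hc2 : ContinuousOn (fun t : ℝ => (t + ε)⁻¹ * (t * t)) (spectrum ℝ S) :=
    hc.mul (by fun_prop)
  -- The witness is `A (|A| + ε)⁻¹`. It is a contraction as `t / (t + ε) ≤ 1`, and its adjoint times
  -- `A` is `|A|² (|A| + ε)⁻¹ ≥ |A| - ε`.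
  refine ⟨A * Y, ?_, fun x => ?_⟩
  · have h1 : star (A * Y) * (A * Y) = cfc (fun t : ℝ => (t + ε)⁻¹ * (t * t) * (t + ε)⁻¹) S := by
      rw [cfc_mul _ _ S hc2 hc, ← hYSS, hSS, star_mul, hYsa]
      simp only [mul_assoc]
      rfl
    have h2 : ‖A * Y‖ * ‖A * Y‖ ≤ 1 := by
      rw [← CStarRing.norm_star_mul_self, h1]
      refine norm_cfc_le zero_le_one fun t ht => ?_
      have ht0 := hsp t ht
      have : 0 < t + ε := by positivity
      rw [Real.norm_of_nonneg (by positivity)]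
      have e : (t + ε)⁻¹ * (t * t) * (t + ε)⁻¹ = (t / (t + ε)) ^ 2 := by
        field_simp
      rw [e]
      exact pow_le_one₀ (by positivity) ((div_le_one this).mpr (by linarith))
    nlinarith [norm_nonneg (A * Y)]
  · have h3 : S - algebraMap ℝ (𝓗 →L[ℂ] 𝓗) ε ≤ Y * (S * S) := by
      have h4 : S - algebraMap ℝ (𝓗 →L[ℂ] 𝓗) ε = cfc (fun t : ℝ => t - ε) S := by
        rw [cfc_sub (fun t : ℝ => t) (fun _ => ε) S, hid, cfc_const ε S]
      rw [h4, hYSS]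
      refine cfc_mono (fun t ht => ?_) (by fun_prop) hc2
      have ht0 := hsp t ht
      have : 0 < t + ε := by positivity
      rw [inv_mul_eq_div, le_div_iff₀ this]
      nlinarith
    have h5 := re_inner_mono h3 x
    rw [sub_apply, inner_sub_right, Complex.sub_re] at h5
    have e1 : (inner ℂ x (algebraMap ℝ (𝓗 →L[ℂ] 𝓗) ε x)).re = ε * ‖x‖ ^ 2 := by
      rw [Algebra.algebraMap_eq_smul_one, smul_apply, one_apply_eq_self, inner_smul_right_eq_smul]
      have : (inner ℂ x x).re = ‖x‖ ^ 2 := inner_self_eq_norm_sq (𝕜 := ℂ) x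
      rw [Complex.smul_re, this, smul_eq_mul]
    have e2 : inner ℂ x ((Y * (S * S)) x) = inner ℂ ((A * Y) x) (A x) := by
      have : Y * (S * S) = star (A * Y) * A := by rw [hSS, star_mul, hYsa, mul_assoc]
      rw [this, mul_apply_eq_comp (star (A * Y)), ContinuousLinearMap.star_eq_adjoint,
        ContinuousLinearMap.adjoint_inner_right]
    rw [e1, e2] at h5
    linarith

/-- The diagonal of `|K X|` is estimated by `⟨W e_i, K X e_i⟩` with a contraction `W`. Splitting `K
= L₁² - L₂²` and moving one factor to each side bounds the partial sums independently of `W`, by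
Hilbert-Schmidt norms. -/
theorem IsTraceClass.mul_right {K : 𝓗 →L[ℂ] 𝓗} (hK : IsTraceClass K) (hsa : IsSelfAdjoint K)
    (X : 𝓗 →L[ℂ] 𝓗) : IsTraceClass (K * X) := by
  obtain ⟨L₁, L₂, h1, h2, hKL⟩ := hK.exists_hs_decomposition hsa
  have key : ∀ L : 𝓗 →L[ℂ] 𝓗, IsSelfAdjoint L → IsHS L → ∀ W : 𝓗 →L[ℂ] 𝓗, ‖W‖ ≤ 1 →
      ∀ F : Finset (basisIndex 𝓗),
      ∑ i ∈ F, ‖inner ℂ (W (basis 𝓗 i)) ((L * L * X) (basis 𝓗 i))‖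
        ≤ (hsNormSq L + hsNormSq (L * X)) / 2 := by
    intro L hL hs W hW F
    have hb : ∀ i, ‖inner ℂ (W (basis 𝓗 i)) ((L * L * X) (basis 𝓗 i))‖
        ≤ (‖(L * W) (basis 𝓗 i)‖ ^ 2 + ‖(L * X) (basis 𝓗 i)‖ ^ 2) / 2 := fun i => by
      rw [mul_apply_eq_comp (L * L), inner_mul_self_of_isSelfAdjoint hL]
      exact norm_inner_le_half _ _
    have hLW : hsNormSq (L * W) ≤ hsNormSq L := by
      refine (hsNormSq_mul_right_le hs W).trans ?_
      have h0 : 0 ≤ hsNormSq L := tsum_nonneg fun _ => by positivity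
      exact mul_le_of_le_one_left h0 (pow_le_one₀ (norm_nonneg _) hW)
    refine (Finset.sum_le_sum fun i _ => hb i).trans ?_
    rw [← Finset.sum_div, Finset.sum_add_distrib]
    have s1 := (hs.mul_right W).sum_le_tsum F fun i _ => by positivity
    have s2 := (hs.mul_right X).sum_le_tsum F fun i _ => by positivity
    have s1' : ∑ i ∈ F, ‖(L * W) (basis 𝓗 i)‖ ^ 2 ≤ hsNormSq (L * W) := s1
    have s2' : ∑ i ∈ F, ‖(L * X) (basis 𝓗 i)‖ ^ 2 ≤ hsNormSq (L * X) := s2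
    linarith
  set C := (hsNormSq L₁ + hsNormSq (L₁ * X)) / 2 + (hsNormSq L₂ + hsNormSq (L₂ * X)) / 2
  have hbound : ∀ F : Finset (basisIndex 𝓗),
      ∑ i ∈ F, (inner ℂ (basis 𝓗 i) (CFC.abs (K * X) (basis 𝓗 i))).re ≤ C := by
    intro F
    -- The polar error `ε` is incurred once per index of `F`, so it is sent to 0 with `F` fixed.
    have hlim : Tendsto (fun ε : ℝ => C + ε * F.card) (𝓝[>] 0) (𝓝 C) := by
      have : Tendsto (fun ε : ℝ => C + ε * F.card) (𝓝 0) (𝓝 (C + 0 * F.card)) :=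
        (Continuous.tendsto (by fun_prop) 0)
      rw [zero_mul, add_zero] at this
      exact this.mono_left nhdsWithin_le_nhds
    refine ge_of_tendsto hlim ?_
    filter_upwards [self_mem_nhdsWithin] with ε hε
    obtain ⟨W, hW, hWx⟩ := exists_approx_polar (K * X) (hε : 0 < ε)
    have hi : ∀ i, (inner ℂ (basis 𝓗 i) (CFC.abs (K * X) (basis 𝓗 i))).re
        ≤ ‖inner ℂ (W (basis 𝓗 i)) ((L₁ * L₁ * X) (basis 𝓗 i))‖
          + ‖inner ℂ (W (basis 𝓗 i)) ((L₂ * L₂ * X) (basis 𝓗 i))‖ + ε := fun i => by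
      refine (hWx _).trans ?_
      rw [(basis 𝓗).orthonormal.1 i, one_pow, mul_one]
      gcongr
      rw [hKL, sub_mul, sub_apply, inner_sub_right]
      exact (Complex.re_le_norm _).trans (norm_sub_le _ _)
    refine (Finset.sum_le_sum fun i _ => hi i).trans ?_
    rw [Finset.sum_add_distrib, Finset.sum_add_distrib, Finset.sum_const, nsmul_eq_mul]
    have k1 := key L₁ h1.1 h1.2 W hW F
    have k2 := key L₂ h2.1 h2.2 W hW F
    simp only [C]
    linarith
  refine lt_of_le_of_lt (b := ENNReal.ofReal C) ?_ ENNReal.ofReal_lt_top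
  rw [traceNorm, ENNReal.tsum_eq_iSup_sum]
  refine iSup_le fun F => ?_
  rw [← ENNReal.ofReal_sum_of_nonneg fun i _ =>
    re_inner_self_nonneg_of_nonneg (CFC.abs_nonneg (K * X)) _]
  exact ENNReal.ofReal_le_ofReal (hbound F)

/-! ### Finite-dimensional compressions -/

/-- An eigenbasis `e`, with eigenvalues `α`, of the compression of `A` to the subspace `W`. -/
structure RitzSystem (A : 𝓗 →ₗ.[ℂ] 𝓗) (W : Submodule ℂ 𝓗) where
  /-- The dimension. -/
  n : ℕ
  /-- The eigenvectors. -/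
  e : Fin n → 𝓗
  /-- The eigenvalues. -/
  α : Fin n → ℝ
  orthonormal : Orthonormal ℂ e
  mem : ∀ j, e j ∈ W
  expand : ∀ u ∈ W, ∑ j, inner ℂ (e j) u • e j = u
  eig : ∀ j, ∀ u : A.domain, (u : 𝓗) ∈ W → inner ℂ (e j) (A u) = α j * inner ℂ (e j) (u : 𝓗)

theorem nonempty_ritzSystem {A : 𝓗 →ₗ.[ℂ] 𝓗} (hA : IsSelfAdjoint A) (W : Submodule ℂ 𝓗)
    [FiniteDimensional ℂ W] (hW : W ≤ A.domain) : Nonempty (RitzSystem A W) := by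
  let T : W →ₗ[ℂ] W :=
    (W.orthogonalProjectionOnto : 𝓗 →ₗ[ℂ] W) ∘ₗ A.toFun ∘ₗ Submodule.inclusion hW
  have hTi : ∀ u v : W, inner ℂ u (T v) = inner ℂ (u : 𝓗) (A (Submodule.inclusion hW v)) :=
    fun u v => Submodule.inner_orthogonalProjectionOnto_eq_of_mem_left u _
  have hT : T.IsSymmetric := by
    intro u v
    rw [hTi, ← inner_conj_symm, hTi, inner_conj_symm]
    exact inner_symm_of_isSelfAdjoint hA (Submodule.inclusion hW u) (Submodule.inclusion hW v)
  let b := hT.eigenvectorBasis rfl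
  refine ⟨⟨_, fun j => (b j : 𝓗), hT.eigenvalues rfl, ?_, fun j => (b j).2, fun u hu => ?_,
    fun j u hu => ?_⟩⟩
  · exact b.orthonormal.comp_linearIsometry W.subtypeₗᵢ
  · have := congrArg (Subtype.val) (b.sum_repr' ⟨u, hu⟩)
    simpa using this
  · have h1 := hTi (b j) ⟨u, hu⟩
    rw [← hT, hT.apply_eigenvectorBasis, inner_smul_left] at h1
    have h2 : Submodule.inclusion hW ⟨u, hu⟩ = u := rfl
    rw [h2] at h1
    rw [← h1]
    simp [b]

namespace RitzSystem

variable {A : 𝓗 →ₗ.[ℂ] 𝓗} {W : Submodule ℂ 𝓗} (R : RitzSystem A W)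

/-- The functional calculus of the compression. -/
def func (g : ℝ → ℂ) : 𝓗 →L[ℂ] 𝓗 :=
  ∑ j, (innerSL ℂ (R.e j)).smulRight (g (R.α j) • R.e j)

theorem func_apply (g : ℝ → ℂ) (x : 𝓗) :
    R.func g x = ∑ j, (g (R.α j) * inner ℂ (R.e j) x) • R.e j := by
  rw [func, sum_apply]
  refine Finset.sum_congr rfl fun j _ => ?_
  rw [ContinuousLinearMap.smulRight_apply, innerSL_apply_apply, smul_smul, mul_comm]

theorem inner_func (g : ℝ → ℂ) (x : 𝓗) (j : Fin R.n) :
    inner ℂ (R.e j) (R.func g x) = g (R.α j) * inner ℂ (R.e j) x := by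
  rw [func_apply, R.orthonormal.inner_right_fintype]

theorem norm_func_le {g : ℝ → ℂ} {C : ℝ} (hC : ∀ l, ‖g l‖ ≤ C) (x : 𝓗) :
    ‖R.func g x‖ ≤ C * ‖x‖ := by
  have hC0 : 0 ≤ C := (norm_nonneg _).trans (hC 0)
  refine le_of_sq_le_sq ?_ (by positivity)
  have h1 : ‖R.func g x‖ ^ 2 = ∑ j, ‖g (R.α j) * inner ℂ (R.e j) x‖ ^ 2 := by
    have h := R.orthonormal.inner_sum (fun j => g (R.α j) * inner ℂ (R.e j) x)
      (fun j => g (R.α j) * inner ℂ (R.e j) x) Finset.univ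
    rw [← R.func_apply, inner_self_eq_norm_sq_to_K] at h
    refine Complex.ofReal_injective ?_
    push_cast
    simp only [Complex.coe_algebraMap] at h
    rw [h]
    refine Finset.sum_congr rfl fun j _ => ?_
    rw [← Complex.normSq_eq_conj_mul_self, Complex.normSq_eq_norm_sq]
    push_cast
    rfl
  rw [h1, mul_pow]
  calc _ ≤ ∑ j, C ^ 2 * ‖inner ℂ (R.e j) x‖ ^ 2 := by
        refine Finset.sum_le_sum fun j _ => ?_
        rw [norm_mul, mul_pow]
        gcongr
        exact hC _
    _ ≤ _ := by
        rw [← Finset.mul_sum]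
        gcongr
        exact R.orthonormal.sum_inner_products_le x

theorem func_add (f g : ℝ → ℂ) (x : 𝓗) :
    R.func (fun l => f l + g l) x = R.func f x + R.func g x := by
  simp only [func_apply, ← Finset.sum_add_distrib, add_mul, add_smul]

theorem func_sub (f g : ℝ → ℂ) (x : 𝓗) :
    R.func (fun l => f l - g l) x = R.func f x - R.func g x := by
  simp only [func_apply, ← Finset.sum_sub_distrib, sub_mul, sub_smul]

theorem func_mul (f g : ℝ → ℂ) (x : 𝓗) :
    R.func (fun l => f l * g l) x = R.func f (R.func g x) := by
  rw [func_apply, func_apply]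
  simp only [inner_func, mul_assoc]

theorem func_const (c : ℂ) {u : 𝓗} (hu : u ∈ W) : R.func (fun _ => c) u = c • u := by
  rw [func_apply]
  conv_rhs => rw [← R.expand u hu, Finset.smul_sum]
  simp only [smul_smul]

/-- For `u` in `W` the compressed resolvent inverts `A + σ i` exactly, although `A u` may leave `W`:
only the components of `A u` along `W` matter. All convergence of compressions starts here. -/
theorem func_res {σ : ℝ} (hσ : σ ≠ 0) (u : A.domain) (hu : (u : 𝓗) ∈ W) :
    R.func (res σ) (A u + (σ * Complex.I : ℂ) • (u : 𝓗)) = u := by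
  rw [func_apply]
  conv_rhs => rw [← R.expand u hu]
  refine Finset.sum_congr rfl fun j _ => ?_
  rw [inner_add_right, inner_smul_right, R.eig j u hu, ← add_mul, ← mul_assoc, res,
    inv_mul_cancel₀ (add_mul_I_ne_zero hσ _), one_mul]

theorem sum_norm_sq_inner {u : 𝓗} (hu : u ∈ W) : ∑ j, ‖inner ℂ (R.e j) u‖ ^ 2 = ‖u‖ ^ 2 := by
  have h : inner ℂ u u = ∑ j, inner ℂ (R.e j) u * inner ℂ u (R.e j) := by
    conv_lhs => rw [← R.expand u hu, inner_sum]
    rw [R.expand u hu]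
    simp only [inner_smul_right]
  rw [inner_self_eq_norm_sq_to_K] at h
  refine Complex.ofReal_injective ?_
  push_cast
  simp only [Complex.coe_algebraMap] at h
  rw [h]
  refine Finset.sum_congr rfl fun j _ => ?_
  rw [← inner_conj_symm u, Complex.mul_conj, Complex.normSq_eq_norm_sq]
  push_cast
  rfl

theorem inner_self_apply (u : A.domain) (hu : (u : 𝓗) ∈ W) :
    inner ℂ (u : 𝓗) (A u) = ((∑ j, R.α j * ‖inner ℂ (R.e j) (u : 𝓗)‖ ^ 2 : ℝ) : ℂ) := by
  have h : inner ℂ (u : 𝓗) (A u) = ∑ j, inner ℂ (u : 𝓗) (R.e j) * inner ℂ (R.e j) (A u) := by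
    conv_lhs => rw [← R.expand u hu, sum_inner]
    refine Finset.sum_congr rfl fun j _ => ?_
    rw [inner_smul_left, inner_conj_symm]
  rw [h]
  push_cast
  refine Finset.sum_congr rfl fun j _ => ?_
  rw [R.eig j u hu, ← inner_conj_symm (u : 𝓗), mul_left_comm,
    ← Complex.normSq_eq_conj_mul_self, Complex.normSq_eq_norm_sq]
  push_cast
  rfl

/-- `tr (K φ(A_W))` where `A_W` is the compression of `A` to `W`. -/
def traceMul (φ : ℝ → ℝ) (K : 𝓗 →L[ℂ] 𝓗) : ℂ :=
  ∑ j, (φ (R.α j) : ℂ) * inner ℂ (R.e j) (K (R.e j))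

theorem traceMul_sub (φ : ℝ → ℝ) (K K' : 𝓗 →L[ℂ] 𝓗) :
    R.traceMul φ (K - K') = R.traceMul φ K - R.traceMul φ K' := by
  simp only [traceMul, ← Finset.sum_sub_distrib, sub_apply, inner_sub_right, mul_sub]

/-- The finite trace takes the same form as in `trace_sq_mul`, ready for dominated convergence over
a fixed basis. -/
theorem traceMul_eq_tsum (φ : ℝ → ℝ) {L : 𝓗 →L[ℂ] 𝓗} (hL : IsSelfAdjoint L) :
    R.traceMul φ (L * L)
      = ∑' i, inner ℂ (L (basis 𝓗 i)) (R.func (fun l => (φ l : ℂ)) (L (basis 𝓗 i))) := by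
  have hs : ∀ j, HasSum (fun i => (φ (R.α j) : ℂ)
      * (inner ℂ (L (basis 𝓗 i)) (R.e j) * inner ℂ (R.e j) (L (basis 𝓗 i))))
      ((φ (R.α j) : ℂ) * inner ℂ (R.e j) ((L * L) (R.e j))) := by
    intro j
    refine HasSum.mul_left _ ?_
    rw [inner_mul_self_of_isSelfAdjoint hL]
    refine ((basis 𝓗).hasSum_inner_mul_inner (L (R.e j)) (L (R.e j))).congr_fun fun i => ?_
    have e1 : inner ℂ (L (basis 𝓗 i)) (R.e j) = inner ℂ (basis 𝓗 i) (L (R.e j)) :=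
      hL.isSymmetric _ _
    have e2 : inner ℂ (L (R.e j)) (basis 𝓗 i) = inner ℂ (R.e j) (L (basis 𝓗 i)) :=
      hL.isSymmetric _ _
    rw [e1, ← e2, mul_comm]
  have h := hasSum_sum (s := Finset.univ) fun j _ => hs j
  rw [traceMul, ← h.tsum_eq]
  congr 1
  ext i
  rw [func_apply, inner_sum]
  refine Finset.sum_congr rfl fun j _ => ?_
  rw [inner_smul_right]
  ring

end RitzSystem

/-- The weights `p j k = |⟨e_j, f_k⟩|²` sum to 1 in each row and column. As `K` is the difference of
the two forms on `W`, its diagonal entries in the two bases are the row and column sums of `p j k *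
(α_j - β_k)`. Both traces become double sums of this array, weighted by `φ(α_j)` and by `φ(β_k)`. -/
theorem re_traceMul_sub_nonpos {A B : 𝓗 →ₗ.[ℂ] 𝓗} {W : Submodule ℂ 𝓗} (R : RitzSystem A W)
    (S : RitzSystem B W) (hA : W ≤ A.domain) (hB : W ≤ B.domain) {K : 𝓗 →L[ℂ] 𝓗}
    (hK : ∀ (u : 𝓗) (hu : u ∈ W), A ⟨u, hA hu⟩ - B ⟨u, hB hu⟩ = K u) {φ : ℝ → ℝ}
    (hφ : Antitone φ) : (R.traceMul φ K).re ≤ (S.traceMul φ K).re := by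
  set p : Fin R.n → Fin S.n → ℝ := fun j k => ‖inner ℂ (R.e j) (S.e k)‖ ^ 2 with hp
  have hq : ∀ u (hu : u ∈ W), inner ℂ u (K u)
      = ((∑ j, R.α j * ‖inner ℂ (R.e j) u‖ ^ 2
        - ∑ k, S.α k * ‖inner ℂ (S.e k) u‖ ^ 2 : ℝ) : ℂ) := by
    intro u hu
    rw [← hK u hu, inner_sub_right, R.inner_self_apply ⟨u, hA hu⟩ hu,
      S.inner_self_apply ⟨u, hB hu⟩ hu, Complex.ofReal_sub]
  have hR : ∀ j, inner ℂ (R.e j) (K (R.e j)) = ((∑ k, p j k * (R.α j - S.α k) : ℝ) : ℂ) := by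
    intro j
    rw [hq _ (R.mem j)]
    congr 1
    have h1 : ∑ i, R.α i * ‖inner ℂ (R.e i) (R.e j)‖ ^ 2 = R.α j := by
      simp only [orthonormal_iff_ite.mp R.orthonormal]
      rw [Finset.sum_eq_single j (fun i _ hi => by simp [hi]) (by simp)]
      simp
    have h2 := S.sum_norm_sq_inner (R.mem j)
    rw [R.orthonormal.1 j, one_pow] at h2
    rw [h1]
    have h3 : ∀ k, ‖inner ℂ (S.e k) (R.e j)‖ ^ 2 = p j k := fun k => by
      rw [hp, norm_inner_symm]
    simp only [h3] at h2 ⊢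
    have h4 : R.α j = ∑ k, R.α j * p j k := by rw [← Finset.mul_sum, h2, mul_one]
    conv_lhs => rw [h4, ← Finset.sum_sub_distrib]
    exact Finset.sum_congr rfl fun k _ => by ring
  have hS : ∀ k, inner ℂ (S.e k) (K (S.e k)) = ((∑ j, p j k * (R.α j - S.α k) : ℝ) : ℂ) := by
    intro k
    rw [hq _ (S.mem k)]
    congr 1
    have h1 : ∑ i, S.α i * ‖inner ℂ (S.e i) (S.e k)‖ ^ 2 = S.α k := by
      simp only [orthonormal_iff_ite.mp S.orthonormal]
      rw [Finset.sum_eq_single k (fun i _ hi => by simp [hi]) (by simp)]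
      simp
    have h2 := R.sum_norm_sq_inner (S.mem k)
    rw [S.orthonormal.1 k, one_pow] at h2
    rw [h1]
    have h3 : ∀ j, ‖inner ℂ (R.e j) (S.e k)‖ ^ 2 = p j k := fun j => rfl
    simp only [h3] at h2 ⊢
    have h4 : S.α k = ∑ j, S.α k * p j k := by rw [← Finset.mul_sum, h2, mul_one]
    conv_lhs => rw [h4, ← Finset.sum_sub_distrib]
    exact Finset.sum_congr rfl fun j _ => by ring
  have eR : (R.traceMul φ K).re = ∑ j, ∑ k, φ (R.α j) * (p j k * (R.α j - S.α k)) := by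
    simp only [RitzSystem.traceMul, hR, ← Complex.ofReal_mul, ← Complex.ofReal_sum,
      Complex.ofReal_re, Finset.mul_sum]
  have eS : (S.traceMul φ K).re = ∑ j, ∑ k, φ (S.α k) * (p j k * (R.α j - S.α k)) := by
    rw [Finset.sum_comm]
    simp only [RitzSystem.traceMul, hS, ← Complex.ofReal_mul, ← Complex.ofReal_sum,
      Complex.ofReal_re, Finset.mul_sum]
  rw [eR, eS]
  refine Finset.sum_le_sum fun j _ => Finset.sum_le_sum fun k _ => ?_
  have hp0 : 0 ≤ p j k := by positivity
  have : (φ (R.α j) - φ (S.α k)) * (R.α j - S.α k) ≤ 0 := by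
    rcases le_total (R.α j) (S.α k) with h | h
    · exact mul_nonpos_of_nonneg_of_nonpos (sub_nonneg.mpr (hφ h)) (sub_nonpos.mpr h)
    · exact mul_nonpos_of_nonpos_of_nonneg (sub_nonpos.mpr (hφ h)) (sub_nonneg.mpr h)
  nlinarith [mul_nonpos_of_nonneg_of_nonpos hp0 this]

/-! ### Strong convergence of the functional calculus of compressions -/

theorem tendsto_apply_of_dense {ι : Type*} {l : Filter ι} {T : ι → 𝓗 →L[ℂ] 𝓗} {S : 𝓗 →L[ℂ] 𝓗}
    {C : ℝ} (hC : ∀ i x, ‖T i x‖ ≤ C * ‖x‖) {D : Set 𝓗} (hD : Dense D)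
    (h : ∀ x ∈ D, Tendsto (fun i => T i x) l (𝓝 (S x))) (x : 𝓗) :
    Tendsto (fun i => T i x) l (𝓝 (S x)) := by
  rw [Metric.tendsto_nhds]
  intro ε hε
  set M := |C| + ‖S‖ + 1
  have hM : 0 < M := by positivity
  obtain ⟨y, hy, hxy⟩ := Metric.dense_iff.mp hD x (ε / (2 * M)) (by positivity)
  rw [Metric.mem_ball, dist_eq_norm, norm_sub_rev] at hy
  filter_upwards [Metric.tendsto_nhds.mp (h y hxy) (ε / 2) (by positivity)] with i hi
  rw [dist_eq_norm] at hi ⊢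
  have e : T i x - S x = T i (x - y) + (T i y - S y) - S (x - y) := by
    simp only [map_sub]; abel
  have h1 : ‖T i (x - y)‖ ≤ |C| * ‖x - y‖ :=
    (hC i _).trans (mul_le_mul_of_nonneg_right (le_abs_self C) (norm_nonneg _))
  have h2 := S.le_opNorm (x - y)
  have h3 : (|C| + ‖S‖) * ‖x - y‖ ≤ ε / 2 := by
    calc (|C| + ‖S‖) * ‖x - y‖ ≤ M * (ε / (2 * M)) := by
          apply mul_le_mul (by simp [M]) hy.le (norm_nonneg _) hM.le
      _ = ε / 2 := by field_simp
  calc ‖T i x - S x‖ ≤ ‖T i (x - y)‖ + ‖T i y - S y‖ + ‖S (x - y)‖ := by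
        rw [e]; exact (norm_sub_le _ _).trans (add_le_add_left (norm_add_le _ _) _)
    _ < ε := by linarith

theorem norm_res_one_le (l : ℝ) : res 1 l ∈ Metric.closedBall (0 : ℂ) 1 := by
  simpa using norm_res_le one_ne_zero l

section Convergence

variable {ι : Type*} {l : Filter ι} {A : 𝓗 →ₗ.[ℂ] 𝓗} {W : ι → Submodule ℂ 𝓗}
  {E : ProjectionValuedMeasure 𝓗} (R : ∀ i, RitzSystem A (W i))

theorem tendsto_func_const (hd : Dense (A.domain : Set 𝓗))
    (hW : ∀ u ∈ A.domain, ∀ᶠ i in l, u ∈ W i) (c : ℂ) (x : 𝓗) :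
    Tendsto (fun i => (R i).func (fun _ => c) x) l (𝓝 (E.integral (fun _ => c) x)) := by
  refine tendsto_apply_of_dense (C := ‖c‖) (fun i x => (R i).norm_func_le (fun _ => le_rfl) x) hd
    (fun u hu => ?_) x
  refine tendsto_const_nhds.congr' ?_
  filter_upwards [hW u hu] with i hi
  rw [(R i).func_const c hi, E.integral_const]
  simp

/-- Every `x` is `(A + σ i) u` with `u` in the domain, and `u` eventually lies in `W i`; hence
equality and not merely a limit. -/
theorem eventually_func_res (hE : IsSpectralMeasure E A) (hd : Dense (A.domain : Set 𝓗))
    (hW : ∀ u ∈ A.domain, ∀ᶠ i in l, u ∈ W i) {σ : ℝ} (hσ : σ ≠ 0) (x : 𝓗) :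
    ∀ᶠ i in l, (R i).func (res σ) x = E.integral (res σ) x := by
  obtain ⟨u, rfl⟩ := hE.exists_domain hd hσ x
  filter_upwards [hW u u.2] with i hi
  rw [(R i).func_res hσ u hi, hE.integral_res_apply hd hσ]

theorem tendsto_func_mul {f g : ℝ → ℂ} (hf : BddMeas f) (hg : BddMeas g)
    (h1 : ∀ x, Tendsto (fun i => (R i).func f x) l (𝓝 (E.integral f x)))
    (h2 : ∀ x, Tendsto (fun i => (R i).func g x) l (𝓝 (E.integral g x))) (x : 𝓗) :
    Tendsto (fun i => (R i).func (fun l => f l * g l) x) l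
      (𝓝 (E.integral (fun l => f l * g l) x)) := by
  obtain ⟨C, hC⟩ := hf.bdd
  rw [E.integral_mul hf hg, mul_apply_eq_comp]
  simp only [RitzSystem.func_mul]
  have h3 : Tendsto (fun i => (R i).func f ((R i).func g x - E.integral g x)) l (𝓝 0) := by
    rw [tendsto_zero_iff_norm_tendsto_zero]
    refine squeeze_zero (fun _ => norm_nonneg _) (fun i => (R i).norm_func_le hC _) ?_
    have := (tendsto_iff_norm_sub_tendsto_zero.mp (h2 x)).const_mul C
    simpa using this
  have h4 := h3.add (h1 (E.integral g x))
  rw [zero_add] at h4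
  refine h4.congr fun i => ?_
  rw [map_sub, sub_add_cancel]

theorem tendsto_func_of_uniform {f : ℝ → ℂ} (hf : BddMeas f)
    (h : ∀ ε > 0, ∃ g, BddMeas g ∧ (∀ l, ‖f l - g l‖ ≤ ε) ∧
      ∀ x, Tendsto (fun i => (R i).func g x) l (𝓝 (E.integral g x))) (x : 𝓗) :
    Tendsto (fun i => (R i).func f x) l (𝓝 (E.integral f x)) := by
  rw [Metric.tendsto_nhds]
  intro ε hε
  set δ := ε / (4 * (‖x‖ + 1))
  have hx : 0 < ‖x‖ + 1 := by positivity
  have hδ : 0 < δ := by positivity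
  obtain ⟨g, hg, hfg, ht⟩ := h δ hδ
  filter_upwards [Metric.tendsto_nhds.mp (ht x) (ε / 4) (by positivity)] with i hi
  rw [dist_eq_norm] at hi ⊢
  have h1 : ‖(R i).func f x - (R i).func g x‖ ≤ δ * ‖x‖ := by
    rw [← RitzSystem.func_sub]
    exact (R i).norm_func_le hfg x
  have h2 : ‖E.integral f x - E.integral g x‖ ≤ 2 * δ * ‖x‖ := by
    have := E.norm_integral_le (hf.sub hg) hfg
    rw [E.integral_sub hf hg] at this
    exact ((E.integral f - E.integral g).le_opNorm x).trans
      (mul_le_mul_of_nonneg_right this (norm_nonneg _))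
  have h3 : δ * ‖x‖ ≤ ε / 4 := by
    calc δ * ‖x‖ ≤ δ * (‖x‖ + 1) := by gcongr; linarith
      _ = ε / 4 := by simp only [δ]; field_simp
  have e : (R i).func f x - E.integral f x = ((R i).func f x - (R i).func g x)
      + ((R i).func g x - E.integral g x) - (E.integral f x - E.integral g x) := by abel
  calc _ ≤ ‖(R i).func f x - (R i).func g x‖ + ‖(R i).func g x - E.integral g x‖
        + ‖E.integral f x - E.integral g x‖ := by
        rw [e]; exact (norm_sub_le _ _).trans (add_le_add_left (norm_add_le _ _) _)
    _ < ε := by linarith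

theorem bddMeas_comp_res (f : C(Metric.closedBall (0 : ℂ) 1, ℂ)) :
    BddMeas fun l => f ⟨res 1 l, norm_res_one_le l⟩ :=
  ⟨(f.continuous.comp ((continuous_res one_ne_zero).subtype_mk _)).measurable, ‖f‖,
    fun _ => f.norm_coe_le_norm _⟩

/-- Stone-Weierstrass on the closed unit disc: the functions for which convergence holds form a
closed algebra, containing the coordinate and its conjugate, which correspond to `res 1` and `res
(-1)`. -/
theorem tendsto_func_comp_res (hE : IsSpectralMeasure E A) (hd : Dense (A.domain : Set 𝓗))
    (hW : ∀ u ∈ A.domain, ∀ᶠ i in l, u ∈ W i) (f : C(Metric.closedBall (0 : ℂ) 1, ℂ)) (x : 𝓗) :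
    Tendsto (fun i => (R i).func (fun l => f ⟨res 1 l, norm_res_one_le l⟩) x) l
      (𝓝 (E.integral (fun l => f ⟨res 1 l, norm_res_one_le l⟩) x)) := by
  have hres : ∀ {σ : ℝ}, σ ≠ 0 → ∀ x,
      Tendsto (fun i => (R i).func (res σ) x) l (𝓝 (E.integral (res σ) x)) := fun hσ x =>
    tendsto_const_nhds.congr' ((eventually_func_res R hE hd hW hσ x).mono fun _ h => h.symm)
  have : CompactSpace (Metric.closedBall (0 : ℂ) 1) :=
    isCompact_iff_compactSpace.mp (isCompact_closedBall 0 1)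
  induction f using ContinuousMap.induction_on_of_compact generalizing x with
  | const r => exact tendsto_func_const R hd hW r x
  | id => exact hres one_ne_zero x
  | star_id =>
    have e : (fun l => (star (ContinuousMap.restrict (Metric.closedBall (0 : ℂ) 1)
        (ContinuousMap.id ℂ))) ⟨res 1 l, norm_res_one_le l⟩) = res (-1) := by
      ext l
      exact conj_res 1 l
    rw [e]
    exact hres (by norm_num) x
  | add f g hf hg =>
    have e := E.integral_add (bddMeas_comp_res f) (bddMeas_comp_res g)
    simp only [ContinuousMap.add_apply]
    rw [e, add_apply]
    simpa only [RitzSystem.func_add] using (hf x).add (hg x)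
  | mul f g hf hg =>
    exact tendsto_func_mul R (bddMeas_comp_res f) (bddMeas_comp_res g) hf hg x
  | frequently f h =>
    refine tendsto_func_of_uniform R (bddMeas_comp_res f) (fun ε hε => ?_) x
    obtain ⟨g, hg, hgf⟩ := (h.and_eventually (Metric.ball_mem_nhds f hε)).exists
    refine ⟨_, bddMeas_comp_res g, fun l => ?_, hg⟩
    have hgf' : ‖f - g‖ < ε := by rw [← dist_eq_norm, dist_comm]; exact hgf
    exact ((f - g).norm_coe_le_norm ⟨res 1 l, norm_res_one_le l⟩).trans hgf'.le

/-- A bounded `φ` may have no limit at infinity, so it need not extend to the disc. The product `φ *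
res 1` does, with value 0 at `w = 0`; the extra resolvent is then absorbed on the dense domain, and
uniform boundedness does the rest. -/
theorem tendsto_func (hE : IsSpectralMeasure E A) (hd : Dense (A.domain : Set 𝓗))
    (hW : ∀ u ∈ A.domain, ∀ᶠ i in l, u ∈ W i) {φ : ℝ → ℝ} (hφ : Continuous φ)
    (hb : ∃ C : ℝ, ∀ x, |φ x| ≤ C) (x : 𝓗) :
    Tendsto (fun i => (R i).func (fun l => (φ l : ℂ)) x) l
      (𝓝 (E.integral (fun l => (φ l : ℂ)) x)) := by
  have hφm := BddMeas.ofReal hφ.measurable hb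
  obtain ⟨C, hC⟩ := hb
  have hcont : Continuous fun w : ℂ => (φ (w⁻¹).re : ℂ) * w := by
    rw [continuous_iff_continuousAt]
    intro w
    by_cases hw : w = 0
    · subst hw
      rw [ContinuousAt, mul_zero, tendsto_zero_iff_norm_tendsto_zero]
      refine squeeze_zero (fun _ => norm_nonneg _) (g := fun w => C * ‖w‖) (fun w => ?_) ?_
      · rw [norm_mul]
        refine mul_le_mul_of_nonneg_right ?_ (norm_nonneg _)
        simpa using hC _
      · have : Tendsto (fun w : ℂ => C * ‖w‖) (𝓝 0) (𝓝 (C * ‖(0 : ℂ)‖)) :=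
          (by fun_prop : Continuous fun w : ℂ => C * ‖w‖).tendsto 0
        simpa using this
    · have h1 : ContinuousAt (fun w : ℂ => (w⁻¹).re) w :=
        Complex.continuous_re.continuousAt.comp (continuousAt_inv₀ hw)
      exact (Complex.continuous_ofReal.continuousAt.comp
        (hφ.continuousAt.comp h1)).mul continuousAt_id
  have key : ∀ y, Tendsto (fun i => (R i).func (fun l => (φ l : ℂ) * res 1 l) y) l
      (𝓝 (E.integral (fun l => (φ l : ℂ) * res 1 l) y)) := by
    intro y
    have h := tendsto_func_comp_res R hE hd hW
      ⟨fun w : Metric.closedBall (0 : ℂ) 1 => (φ ((w : ℂ)⁻¹).re : ℂ) * (w : ℂ),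
        hcont.comp continuous_subtype_val⟩ y
    have e : ∀ l : ℝ, ((res 1 l)⁻¹).re = l := fun l => by
      rw [res, inv_inv]; simp
    simpa only [ContinuousMap.coe_mk, e] using h
  refine tendsto_apply_of_dense (C := C)
    (fun i x => (R i).norm_func_le (fun l => by simpa using hC l) x) hd (fun u hu => ?_) x
  have hu' := hE.integral_res_apply hd one_ne_zero ⟨u, hu⟩
  set y := A ⟨u, hu⟩ + (((1 : ℝ) : ℂ) * Complex.I) • u
  change E.integral (res 1) y = u at hu'
  have h1 := key y
  rw [E.integral_mul hφm (bddMeas_res one_ne_zero), mul_apply_eq_comp, hu'] at h1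
  refine h1.congr' ?_
  -- With `u` the resolvent of `y`, eventually `φ` of the compression at `u` is `φ * res 1` of the
  -- compression at `y`.
  filter_upwards [eventually_func_res R hE hd hW one_ne_zero y] with i hi
  rw [RitzSystem.func_mul, hi, hu']

theorem tendsto_traceMul_sq (hE : IsSpectralMeasure E A) (hd : Dense (A.domain : Set 𝓗))
    (hW : ∀ u ∈ A.domain, ∀ᶠ i in l, u ∈ W i) {φ : ℝ → ℝ} (hφ : Continuous φ)
    (hb : ∃ C : ℝ, ∀ x, |φ x| ≤ C) {L : 𝓗 →L[ℂ] 𝓗} (hL : IsSelfAdjoint L) (hs : IsHS L) :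
    Tendsto (fun i => (R i).traceMul φ (L * L)) l
      (𝓝 (trace (L * L * E.integral fun l => (φ l : ℂ)))) := by
  obtain ⟨C, hC⟩ := hb
  simp only [RitzSystem.traceMul_eq_tsum _ φ hL]
  rw [trace_sq_mul hL hs]
  refine tendsto_tsum_of_dominated_convergence (Summable.mul_left C hs) (fun i => ?_)
    (Eventually.of_forall fun i k => ?_)
  · exact tendsto_const_nhds.inner (tendsto_func R hE hd hW hφ ⟨C, hC⟩ _)
  · refine (norm_inner_le_norm _ _).trans ?_
    have := (R i).norm_func_le (g := fun l => (φ l : ℂ)) (fun l => by simpa using hC l)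
      (L (basis 𝓗 k))
    nlinarith [norm_nonneg (L (basis 𝓗 k))]

theorem tendsto_traceMul (hE : IsSpectralMeasure E A) (hd : Dense (A.domain : Set 𝓗))
    (hW : ∀ u ∈ A.domain, ∀ᶠ i in l, u ∈ W i) {φ : ℝ → ℝ} (hφ : Continuous φ)
    (hb : ∃ C : ℝ, ∀ x, |φ x| ≤ C) {K : 𝓗 →L[ℂ] 𝓗} (hK : IsTraceClass K)
    (hsa : IsSelfAdjoint K) :
    Tendsto (fun i => (R i).traceMul φ K) l
      (𝓝 (trace (K * E.integral fun l => (φ l : ℂ)))) := by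
  obtain ⟨L₁, L₂, h1, h2, rfl⟩ := hK.exists_hs_decomposition hsa
  rw [(traceSummable_sq h1.1 h1.2).trace_sub_mul (traceSummable_sq h2.1 h2.2)]
  simp only [RitzSystem.traceMul_sub]
  exact (tendsto_traceMul_sq R hE hd hW hφ hb h1.1 h1.2).sub
    (tendsto_traceMul_sq R hE hd hW hφ hb h2.1 h2.2)

end Convergence

/-! ### Bounded perturbations -/

theorem isSelfAdjoint_perturb {H₀ : 𝓗 →ₗ.[ℂ] 𝓗} (hH₀ : IsSelfAdjoint H₀) {W : 𝓗 →L[ℂ] 𝓗}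
    (hW : IsSelfAdjoint W) : IsSelfAdjoint (perturb H₀ W) := by
  have hd : Dense ((perturb H₀ W).domain : Set 𝓗) := hH₀.dense_domain
  have hap : ∀ u : (perturb H₀ W).domain, perturb H₀ W u = H₀ (u : H₀.domain) + W (u : 𝓗) :=
    fun _ => rfl
  have hsym : ∀ x y : 𝓗, inner ℂ (W x) y = inner ℂ x (W y) := hW.isSymmetric
  have hfa : (perturb H₀ W).IsFormalAdjoint (perturb H₀ W) := by
    intro u v
    rw [hap, hap, inner_add_left, inner_add_right, hsym]
    congr 1
    exact inner_symm_of_isSelfAdjoint hH₀ u v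
  rw [LinearPMap.isSelfAdjoint_def]
  have hle : perturb H₀ W ≤ (perturb H₀ W).adjoint := hfa.le_adjoint hd
  refine (LinearPMap.eq_of_le_of_domain_eq hle (le_antisymm hle.1 fun y hy => ?_)).symm
  have h1 : ∀ x : H₀.domain, inner ℂ ((perturb H₀ W).adjoint ⟨y, hy⟩ - W y) (x : 𝓗)
      = inner ℂ y (H₀ x) := by
    intro x
    have h : inner ℂ ((perturb H₀ W).adjoint ⟨y, hy⟩) (x : 𝓗) = inner ℂ y (H₀ x + W (x : 𝓗)) :=
      LinearPMap.adjoint_isFormalAdjoint hd ⟨y, hy⟩ x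
    rw [inner_sub_left, h, inner_add_right, hsym, add_sub_cancel_right]
  have h2 : y ∈ H₀.adjoint.domain := LinearPMap.mem_adjoint_domain_of_exists y ⟨_, h1⟩
  rw [LinearPMap.isSelfAdjoint_def.mp hH₀] at h2
  exact h2

theorem isFunctionOf_functionOf {A : 𝓗 →ₗ.[ℂ] 𝓗} (hA : IsSelfAdjoint A) {φ : ℝ → ℝ}
    (hφ : Measurable φ) (hb : ∃ C : ℝ, ∀ x, |φ x| ≤ C) :
    IsFunctionOf A φ (functionOf φ A) := by
  have h := exists_isFunctionOf hA hφ hb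
  rw [functionOf, dif_pos h]
  exact h.choose_spec

/-- The operator brings its own spectral measure. The convergence results hold for any spectral
measure of `A`, so uniqueness is never needed. -/
theorem IsFunctionOf.exists_eq_integral {A : 𝓗 →ₗ.[ℂ] 𝓗} {φ : ℝ → ℝ} (hφ : Measurable φ)
    (hb : ∃ C : ℝ, ∀ x, |φ x| ≤ C) {B : 𝓗 →L[ℂ] 𝓗} (h : IsFunctionOf A φ B) :
    ∃ E, IsSpectralMeasure E A ∧ B = E.integral fun l => (φ l : ℂ) := by
  obtain ⟨E, hE, hB⟩ := h
  refine ⟨E, hE, (ProjectionValuedMeasure.HasIntegral.integral_eq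
    (BddMeas.ofReal hφ hb) fun x => ?_).symm⟩
  rw [hB x, integral_complex_ofReal]

theorem IsFunctionOf.nonneg {A : 𝓗 →ₗ.[ℂ] 𝓗} {φ : ℝ → ℝ} (hφ : ∀ x, 0 ≤ φ x)
    {B : 𝓗 →L[ℂ] 𝓗} (h : IsFunctionOf A φ B) : 0 ≤ B := by
  obtain ⟨E, -, hB⟩ := h
  rw [ContinuousLinearMap.nonneg_iff_isPositive, ContinuousLinearMap.isPositive_iff_complex]
  intro x
  have h1 : inner ℂ (B x) x = ((∫ l, φ l ∂(E.scalarMeasure x) : ℝ) : ℂ) := by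
    rw [← inner_conj_symm, hB x, Complex.conj_ofReal]
  rw [h1]
  exact ⟨by simp, by simpa using integral_nonneg hφ⟩

/-- The map `T ↦ φ(T)` is monotone (in the sense of the trace pairing) along trace class
perturbations. -/
theorem re_trace_sub_mul_le {H₀ : 𝓗 →ₗ.[ℂ] 𝓗} (hH₀ : IsSelfAdjoint H₀) {K₁ K₂ : 𝓗 →L[ℂ] 𝓗}
    (h₁ : IsSelfAdjoint K₁) (h₂ : IsSelfAdjoint K₂) (t₁ : IsTraceClass K₁) (t₂ : IsTraceClass K₂)
    {φ : ℝ → ℝ} (hφ : Continuous φ) (hb : ∃ C : ℝ, ∀ x, |φ x| ≤ C) (hanti : Antitone φ)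
    {B₁ B₂ : 𝓗 →L[ℂ] 𝓗} (hB₁ : IsFunctionOf (perturb H₀ K₁) φ B₁)
    (hB₂ : IsFunctionOf (perturb H₀ K₂) φ B₂) :
    (trace ((K₁ - K₂) * B₁)).re ≤ (trace ((K₁ - K₂) * B₂)).re := by
  obtain ⟨E₁, hE₁, rfl⟩ := hB₁.exists_eq_integral hφ.measurable hb
  obtain ⟨E₂, hE₂, rfl⟩ := hB₂.exists_eq_integral hφ.measurable hb
  -- Spans of finite subsets of the common domain, directed by inclusion; each vector of the domain
  -- eventually belongs to them.
  let W : Finset H₀.domain → Submodule ℂ 𝓗 := fun F =>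
    Submodule.span ℂ (Subtype.val '' (F : Set H₀.domain))
  have hfin : ∀ F, FiniteDimensional ℂ (W F) := fun F =>
    FiniteDimensional.span_of_finite ℂ (F.finite_toSet.image _)
  have hWd : ∀ F, W F ≤ H₀.domain := fun F => by
    rw [Submodule.span_le]
    rintro _ ⟨u, -, rfl⟩
    exact u.2
  have hW : ∀ u ∈ H₀.domain, ∀ᶠ F in atTop, u ∈ W F := fun u hu => by
    filter_upwards [eventually_ge_atTop {⟨u, hu⟩}] with F hF
    exact Submodule.subset_span ⟨⟨u, hu⟩, by simpa using hF, rfl⟩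
  let R : ∀ F, RitzSystem (perturb H₀ K₁) (W F) := fun F =>
    (nonempty_ritzSystem (isSelfAdjoint_perturb hH₀ h₁) (W F) (hWd F)).some
  let S : ∀ F, RitzSystem (perturb H₀ K₂) (W F) := fun F =>
    (nonempty_ritzSystem (isSelfAdjoint_perturb hH₀ h₂) (W F) (hWd F)).some
  have hle : ∀ F, ((R F).traceMul φ (K₁ - K₂)).re ≤ ((S F).traceMul φ (K₁ - K₂)).re := by
    intro F
    refine re_traceMul_sub_nonpos (R F) (S F) (hWd F) (hWd F) (fun u hu => ?_) hanti
    change (H₀ ⟨u, hWd F hu⟩ + K₁ u) - (H₀ ⟨u, hWd F hu⟩ + K₂ u) = K₁ u - K₂ u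
    abel
  have s₁ := t₁.traceSummable h₁
  have s₂ := t₂.traceSummable h₂
  have lim₁ : Tendsto (fun F => (R F).traceMul φ (K₁ - K₂)) atTop
      (𝓝 (trace ((K₁ - K₂) * E₁.integral fun l => (φ l : ℂ)))) := by
    -- The limits are taken for `K₁` and `K₂` separately, which avoids showing that their difference
    -- is trace class.
    rw [s₁.trace_sub_mul s₂]
    simp only [RitzSystem.traceMul_sub]
    exact (tendsto_traceMul R hE₁ hH₀.dense_domain hW hφ hb t₁ h₁).sub
      (tendsto_traceMul R hE₁ hH₀.dense_domain hW hφ hb t₂ h₂)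
  have lim₂ : Tendsto (fun F => (S F).traceMul φ (K₁ - K₂)) atTop
      (𝓝 (trace ((K₁ - K₂) * E₂.integral fun l => (φ l : ℂ)))) := by
    rw [s₁.trace_sub_mul s₂]
    simp only [RitzSystem.traceMul_sub]
    exact (tendsto_traceMul S hE₂ hH₀.dense_domain hW hφ hb t₁ h₁).sub
      (tendsto_traceMul S hE₂ hH₀.dense_domain hW hφ hb t₂ h₂)
  exact le_of_tendsto_of_tendsto' ((Complex.continuous_re.tendsto _).comp lim₁)
    ((Complex.continuous_re.tendsto _).comp lim₂) hle

/-! ### Concave families -/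

theorem HasTraceNormDerivAt.hasDerivAt {W : ℝ → 𝓗 →L[ℂ] 𝓗} {W' : 𝓗 →L[ℂ] 𝓗} {s : ℝ}
    (h : HasTraceNormDerivAt W W' s) : HasDerivAt W W' s := by
  rw [hasDerivAt_iff_tendsto_slope, tendsto_iff_norm_sub_tendsto_zero]
  have h1 : Tendsto (fun t : ℝ => ENNReal.ofReal ‖((t - s : ℝ) : ℂ)⁻¹ • (W t - W s) - W'‖)
      (𝓝[≠] s) (𝓝 0) :=
    tendsto_of_tendsto_of_tendsto_of_le_of_le tendsto_const_nhds h.2 (fun _ => zero_le)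
      fun t => ofReal_norm_le_traceNorm _
  have h2 := (ENNReal.tendsto_toReal ENNReal.zero_ne_top).comp h1
  rw [ENNReal.toReal_zero] at h2
  refine h2.congr fun t => ?_
  simp only [Function.comp]
  rw [ENNReal.toReal_ofReal (norm_nonneg _), slope_def_module, ← Complex.ofReal_inv,
    Complex.coe_smul]

theorem hasDerivAt_re_inner {W : ℝ → 𝓗 →L[ℂ] 𝓗} {W' : 𝓗 →L[ℂ] 𝓗} {s : ℝ}
    (h : HasDerivAt W W' s) (x : 𝓗) :
    HasDerivAt (fun t => (inner ℂ x (W t x)).re) (inner ℂ x (W' x)).re s := by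
  let L : (𝓗 →L[ℂ] 𝓗) →L[ℝ] ℝ := Complex.reCLM.comp
    (((innerSL ℂ x).comp (ContinuousLinearMap.apply ℂ 𝓗 x)).restrictScalars ℝ)
  exact L.hasFDerivAt.comp_hasDerivAt s h

theorem isSelfAdjoint_of_hasDerivAt {W : ℝ → 𝓗 →L[ℂ] 𝓗} {W' : 𝓗 →L[ℂ] 𝓗} {s : ℝ} {U : Set ℝ}
    (hU : U ∈ 𝓝 s) (hW : ∀ t ∈ U, IsSelfAdjoint (W t)) (h : HasDerivAt W W' s) :
    IsSelfAdjoint W' := by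
  have hc : IsClosed {T : 𝓗 →L[ℂ] 𝓗 | IsSelfAdjoint T} := isClosed_eq continuous_star continuous_id
  refine hc.mem_of_tendsto (hasDerivAt_iff_tendsto_slope.mp h) ?_
  filter_upwards [nhdsWithin_le_nhds hU] with t ht
  rw [slope_def_module]
  exact IsSelfAdjoint.smul (IsSelfAdjoint.all _) ((hW t ht).sub (hW s (mem_of_mem_nhds hU)))

theorem le_of_re_inner_le {S T : 𝓗 →L[ℂ] 𝓗} (hS : IsSelfAdjoint S) (hT : IsSelfAdjoint T)
    (h : ∀ x, (inner ℂ x (S x)).re ≤ (inner ℂ x (T x)).re) : S ≤ T := by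
  rw [ContinuousLinearMap.le_def, ContinuousLinearMap.isPositive_def']
  refine ⟨hT.sub hS, fun x => ?_⟩
  rw [ContinuousLinearMap.reApplyInnerSelf_apply, inner_re_symm, sub_apply, inner_sub_right,
    map_sub, sub_nonneg]
  exact h x

/-- By the mean value theorem the difference quotient is `q' c` for some `c` between `s` and `t`,
and `q'` is nonincreasing. -/
theorem slope_bounds {q q' q'' : ℝ → ℝ} {a b : ℝ} (h1 : ∀ s ∈ Ioo a b, HasDerivAt q (q' s) s)
    (h2 : ∀ s ∈ Ioo a b, HasDerivAt q' (q'' s) s) (h3 : ∀ s ∈ Ioo a b, q'' s ≤ 0) {s t : ℝ}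
    (hs : s ∈ Ioo a b) (ht : t ∈ Ioo a b) (hst : s < t) :
    q' t ≤ (t - s)⁻¹ * (q t - q s) ∧ (t - s)⁻¹ * (q t - q s) ≤ q' s := by
  have hanti : AntitoneOn q' (Ioo a b) := by
    refine antitoneOn_of_deriv_nonpos (convex_Ioo a b)
      (fun s hs => (h2 s hs).continuousAt.continuousWithinAt) (fun s hs => ?_) fun s hs => ?_
    · rw [interior_Ioo] at hs
      exact (h2 s hs).differentiableAt.differentiableWithinAt
    · rw [interior_Ioo] at hs
      rw [(h2 s hs).deriv]
      exact h3 s hs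
  have hsub : Icc s t ⊆ Ioo a b := fun c hc => ⟨hs.1.trans_le hc.1, hc.2.trans_lt ht.2⟩
  obtain ⟨c, hc, hcq⟩ := exists_hasDerivAt_eq_slope q q' hst
    (fun c hc => (h1 c (hsub hc)).continuousAt.continuousWithinAt)
    fun c hc => h1 c (hsub (Ioo_subset_Icc_self hc))
  have hc' := hsub (Ioo_subset_Icc_self hc)
  rw [inv_mul_eq_div, ← hcq]
  exact ⟨hanti hc' ht hc.2.le, hanti hs hc' hc.1.le⟩

/-- Difference quotients of a concave operator family lie between the derivatives at the
endpoints. -/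
theorem operator_slope_bounds {W W' W'' : ℝ → 𝓗 →L[ℂ] 𝓗} {a b : ℝ}
    (hsa : ∀ s ∈ Ioo a b, IsSelfAdjoint (W s)) (h1 : ∀ s ∈ Ioo a b, HasDerivAt W (W' s) s)
    (h2 : ∀ s ∈ Ioo a b, HasDerivAt W' (W'' s) s) (h3 : ∀ s ∈ Ioo a b, W'' s ≤ 0) {s t : ℝ}
    (hs : s ∈ Ioo a b) (ht : t ∈ Ioo a b) (hst : s < t) :
    W' t ≤ ((t - s)⁻¹ : ℝ) • (W t - W s) ∧ ((t - s)⁻¹ : ℝ) • (W t - W s) ≤ W' s := by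
  have hsa' : ∀ r ∈ Ioo a b, IsSelfAdjoint (W' r) := fun r hr =>
    isSelfAdjoint_of_hasDerivAt (isOpen_Ioo.mem_nhds hr) hsa (h1 r hr)
  have hD : IsSelfAdjoint (((t - s)⁻¹ : ℝ) • (W t - W s)) :=
    IsSelfAdjoint.smul (IsSelfAdjoint.all _) ((hsa t ht).sub (hsa s hs))
  have hq : ∀ x, (inner ℂ x ((((t - s)⁻¹ : ℝ) • (W t - W s)) x)).re
      = (t - s)⁻¹ * ((inner ℂ x (W t x)).re - (inner ℂ x (W s x)).re) := fun x => by
    rw [← Complex.coe_smul, smul_apply, sub_apply, inner_smul_right, inner_sub_right,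
      Complex.re_ofReal_mul, Complex.sub_re]
  have hb : ∀ x, _ := fun x => slope_bounds (fun r hr => hasDerivAt_re_inner (h1 r hr) x)
    (fun r hr => hasDerivAt_re_inner (h2 r hr) x)
    (fun r hr => by simpa using re_inner_mono (h3 r hr) x) hs ht hst
  exact ⟨le_of_re_inner_le (hsa' t ht) hD fun x => (hq x).symm ▸ (hb x).1,
    le_of_re_inner_le hD (hsa' s hs) fun x => (hq x).symm ▸ (hb x).2⟩

theorem re_trace_mul_le {K K' X : 𝓗 →L[ℂ] 𝓗} (hK : TraceSummable K) (hK' : TraceSummable K')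
    (h : K ≤ K') (hX : 0 ≤ X) : (trace (K * X)).re ≤ (trace (K' * X)).re := by
  have := re_trace_mul_nonneg (hK'.sub hK) (sub_nonneg.mpr h) hX
  rwa [hK'.trace_sub_mul hK, Complex.sub_re, sub_nonneg] at this

end TraceMonotone

end

/-! ### Monotonicity of the trace along the family -/

theorem theorem3p5 {𝓗 : Type*} [NormedAddCommGroup 𝓗] [InnerProductSpace ℂ 𝓗] [CompleteSpace 𝓗]
    [TopologicalSpace.SeparableSpace 𝓗]
    -- the self-adjoint, possibly unbounded operator `H₀`
    (H₀ : 𝓗 →ₗ.[ℂ] 𝓗) (hH₀ : IsSelfAdjoint H₀)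
    -- the trace class family `V` on the open interval `Ω`, `C¹` in trace norm
    (Ω : Set ℝ) (hΩ_open : IsOpen Ω) (hΩ_int : Ω.OrdConnected) (hΩ_zero : (0 : ℝ) ∈ Ω)
    (V V' V'' : ℝ → 𝓗 →L[ℂ] 𝓗)
    (hV_sa : ∀ s ∈ Ω, IsSelfAdjoint (V s))
    (hV_tc : ∀ s ∈ Ω, TraceMonotone.IsTraceClass (V s))
    (hV_deriv : ∀ s ∈ Ω, TraceMonotone.HasTraceNormDerivAt V (V' s) s)
    (hV'_cont : TraceMonotone.TraceNormContinuousOn V' Ω)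
    -- `V'` is `C¹` in trace norm on `(s₁, s₂)` and `V'' ≤ 0` there
    (s₁ s₂ : ℝ) (hs : Set.Ioo s₁ s₂ ⊆ Ω)
    (hV'_deriv : ∀ s ∈ Set.Ioo s₁ s₂, TraceMonotone.HasTraceNormDerivAt V' (V'' s) s)
    (hV''_cont : TraceMonotone.TraceNormContinuousOn V'' (Set.Ioo s₁ s₂))
    (hV''_nonpos : ∀ s ∈ Set.Ioo s₁ s₂, V'' s ≤ 0)
    (φ : ℝ → ℝ) (hφ_bdd : ∃ C : ℝ, ∀ x, |φ x| ≤ C) (hφ_nonneg : ∀ x, 0 ≤ φ x)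
    (hφ_anti : Antitone φ) (hφ_analytic : AnalyticOnNhd ℝ φ Set.univ)
    (hφ_cont : TraceMonotone.HasAnalyticContinuation φ) :
    -- `φ(H(s))` exists, `V'(s) φ(H(s))` is trace class and its trace is real
    (∀ s ∈ Set.Ioo s₁ s₂,
      TraceMonotone.IsFunctionOf (TraceMonotone.perturb H₀ (V s)) φ
        (TraceMonotone.functionOf φ (TraceMonotone.perturb H₀ (V s))) ∧
      TraceMonotone.IsTraceClass
        (V' s * TraceMonotone.functionOf φ (TraceMonotone.perturb H₀ (V s))) ∧
      (TraceMonotone.trace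
        (V' s * TraceMonotone.functionOf φ (TraceMonotone.perturb H₀ (V s)))).im = 0) ∧
    -- `s ↦ tr (V'(s) φ(H(s)))` is nonincreasing
    AntitoneOn
      (fun s => (TraceMonotone.trace
        (V' s * TraceMonotone.functionOf φ (TraceMonotone.perturb H₀ (V s)))).re)
      (Set.Ioo s₁ s₂) := by
  have hφc : Continuous φ := continuous_iff_continuousAt.mpr fun x =>
    (hφ_analytic x (Set.mem_univ x)).continuousAt
  have hV'_sa : ∀ s ∈ Set.Ioo s₁ s₂, IsSelfAdjoint (V' s) := fun s h =>
    TraceMonotone.isSelfAdjoint_of_hasDerivAt (hΩ_open.mem_nhds (hs h)) hV_sa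
      (hV_deriv s (hs h)).hasDerivAt
  have hB : ∀ s ∈ Set.Ioo s₁ s₂, TraceMonotone.IsFunctionOf (TraceMonotone.perturb H₀ (V s)) φ
      (TraceMonotone.functionOf φ (TraceMonotone.perturb H₀ (V s))) := fun s h =>
    TraceMonotone.isFunctionOf_functionOf
      (TraceMonotone.isSelfAdjoint_perturb hH₀ (hV_sa s (hs h))) hφc.measurable hφ_bdd
  have hB0 := fun s h => (hB s h).nonneg hφ_nonneg
  refine ⟨fun s h => ⟨hB s h, (hV_deriv s (hs h)).1.mul_right (hV'_sa s h) _,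
    TraceMonotone.im_trace_mul_eq_zero (hV_deriv s (hs h)).1 (hV'_sa s h)
      (IsSelfAdjoint.of_nonneg (hB0 s h))⟩, fun s h t k hst => ?_⟩
  rcases hst.eq_or_lt with rfl | hst
  · exact le_rfl
  obtain ⟨b₁, b₂⟩ := TraceMonotone.operator_slope_bounds (fun r hr => hV_sa r (hs hr))
    (fun r hr => (hV_deriv r (hs hr)).hasDerivAt) (fun r hr => (hV'_deriv r hr).hasDerivAt)
    hV''_nonpos h k hst
  rw [← Complex.coe_smul] at b₁ b₂
  have hV := fun r hr => (hV_tc r (hs hr)).traceSummable (hV_sa r (hs hr))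
  have hV' := fun r hr => (hV_deriv r (hs hr)).1.traceSummable (hV'_sa r hr)
  have hD := ((hV t k).sub (hV s h)).smul ((t - s)⁻¹ : ℝ)
  -- The outer inequalities pair `V' t ≤ D` with `φ(H(t))` and `D ≤ V' s` with `φ(H(s))`. There
  -- remains `tr(D φ(H(t))) ≤ tr(D φ(H(s)))`, the trace monotonicity of `φ` scaled by `(t - s)⁻¹ ≥
  -- 0`.
  refine (TraceMonotone.re_trace_mul_le (hV' t k) hD b₁ (hB0 t k)).trans
    (le_trans ?_ (TraceMonotone.re_trace_mul_le hD (hV' s h) b₂ (hB0 s h)))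
  rw [TraceMonotone.trace_smul_mul, TraceMonotone.trace_smul_mul, Complex.re_ofReal_mul,
    Complex.re_ofReal_mul]
  exact mul_le_mul_of_nonneg_left (TraceMonotone.re_trace_sub_mul_le hH₀ (hV_sa t (hs k))
    (hV_sa s (hs h)) (hV_tc t (hs k)) (hV_tc s (hs h)) hφc hφ_bdd hφ_anti (hB t k) (hB s h))
    (inv_nonneg.mpr (sub_nonneg.mpr hst.le))
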